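/- Let $R>0$, $0<\alpha<1$ and $z\in\mathbb{C}\setminus(0,\infty)$. Let $(r,\theta)$ be polar coordinates on $\mathbb{R}^2$ and, on $\mathbb{R}^2\setminus\{0\}$, let $$Y=-e^{-i\alpha\theta}\,\Delta\,e^{i\alpha\theta}=-(\partial_{x_1}+i\alpha\,\partial_{x_1}\theta)^2-(\partial_{x_2}+i\alpha\,\partial_{x_2}\theta)^2,\qquad \partial_{x_1}\theta=-\frac{x_2}{|x|^2},\quad \partial_{x_2}\theta=\frac{x_1}{|x|^2}.$$ Suppose that $\varphi\in L^2(B(0,R),d^2x)$ satisfies $(Y-z)\varphi=0$ on $B(0,R)\setminus\{0\}$ in the weak sense, that is, $$\int_{B(0,R)}\overline{(Y-\bar z)\eta}\;\varphi\,d^2x=0\qquad\text{for all }\eta\in C_c^\infty(B(0,R)\setminus\{0\};\mathbb{C}).$$ Then there exist constants $c_0,d_0,c_{-1},d_{-1}\in\mathbb{C}$ such that $$\varphi(r,\theta)=c_0r^{-\alpha}+d_0r^{\alpha}+\big(c_{-1}r^{-1+\alpha}+d_{-1}r^{1-\alpha}\big)e^{-i\theta}+O(r^\gamma)\quad\text{for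 } r\downarrow0,\qquad \gamma=\min\{2-\alpha,\,1+\alpha\}.$$ Here $f(r,\theta)=O(r^\gamma)$ is understood Fourier-mode-wise: there are functions $f_n$ on $(0,R)$, $n\in\mathbb{Z}$, such that $f(r,\theta)=\sum_{n\in\mathbb{Z}}f_n(r)e^{in\theta}$, with convergence in $L^2$ of the circle for almost every $r\in(0,R)$, and for each $n$ one has $f_n(r)=O(r^\gamma)$ as $r\downarrow0$ (not necessarily uniformly in $n$). -/

import Mathlib

open scoped ContDiff ComplexConjugate

noncomputable section

/-- The plane `ℝ²` is identified with `ℂ`, `x = x₁ + i x₂`.  The partial derivative `∂_{x₁}`. -/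
def partialOne (f : ℂ → ℂ) (x : ℂ) : ℂ := fderiv ℝ f x 1

/-- The partial derivative `∂_{x₂}`. -/
def partialTwo (f : ℂ → ℂ) (x : ℂ) : ℂ := fderiv ℝ f x Complex.I

/-- `∂_{x₁} + i α ∂_{x₁}θ`, where `∂_{x₁}θ = -x₂ / |x|²`. -/
def covOne (α : ℝ) (f : ℂ → ℂ) (x : ℂ) : ℂ :=
  partialOne f x + Complex.I * α * ((-x.im / (x.re ^ 2 + x.im ^ 2) : ℝ) : ℂ) * f x

/-- `∂_{x₂} + i α ∂_{x₂}θ`, where `∂_{x₂}θ = x₁ / |x|²`. -/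
def covTwo (α : ℝ) (f : ℂ → ℂ) (x : ℂ) : ℂ :=
  partialTwo f x + Complex.I * α * ((x.re / (x.re ^ 2 + x.im ^ 2) : ℝ) : ℂ) * f x

/-- The differential expression
`Y = -e^{-iαθ} Δ e^{iαθ} = -(∂_{x₁} + iα ∂_{x₁}θ)² - (∂_{x₂} + iα ∂_{x₂}θ)²`
on `ℝ² \ {0}`. -/
def abY (α : ℝ) (f : ℂ → ℂ) (x : ℂ) : ℂ :=
  -covOne α (covOne α f) x - covTwo α (covTwo α f) x

/-- `φ` satisfies `(Y - z) φ = 0` on `B(0,R) \ {0}` in the weak sense: for all test functions `η`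
on the punctured disk, `⟨(Y - z̄) η, φ⟩ = 0` in `L²` (antilinear in the first argument; `Y` is
formally symmetric). -/
def WeaklySolves (α R : ℝ) (z : ℂ) (φ : ℂ → ℂ) : Prop :=
  ∀ η : ℂ → ℂ, ContDiff ℝ ∞ η → HasCompactSupport η →
    tsupport η ⊆ Metric.ball (0 : ℂ) R \ {0} →
    ∫ x in Metric.ball (0 : ℂ) R, conj (abY α η x - conj z * η x) * φ x = 0

/-- The Fourier-mode-wise `f(r,θ) = O(r^γ)` as `r ↓ 0`, for `f` given (up to null sets) in polar
coordinates on `0 < r < R`: one has `f(r,θ) = ∑_{n ∈ ℤ} fₙ(r) e^{inθ}`, the series converging in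
`L²` of the circle for almost every `r ∈ (0,R)`, and `fₙ(r) = O(r^γ)` as `r ↓ 0` for every `n`. -/
def ModewiseBigO (R γ : ℝ) (f : ℝ → ℝ → ℂ) : Prop :=
  ∃ F : ℤ → ℝ → ℂ,
    (∀ᵐ r ∂(MeasureTheory.volume.restrict (Set.Ioo 0 R)),
      MeasureTheory.MemLp (f r) 2
        (MeasureTheory.volume.restrict (Set.Ioc (-Real.pi) Real.pi)) ∧
      Filter.Tendsto
        (fun s : Finset ℤ => MeasureTheory.eLpNorm
          (fun θ : ℝ => f r θ - ∑ n ∈ s, F n r * Complex.exp (Complex.I * n * θ)) 2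
          (MeasureTheory.volume.restrict (Set.Ioc (-Real.pi) Real.pi)))
        Filter.atTop (nhds 0)) ∧
    ∀ n : ℤ, Asymptotics.IsBigO (nhdsWithin 0 (Set.Ioi 0)) (F n) (fun r : ℝ => r ^ γ)

end

/-! Separation of variables turns the statement into an ODE question. If `G` is a test function on
`(0,R)`, then `G(|x|) x^n` is an admissible test function. On it `Y` acts through a radial operator,
because the integer power `x^n` is smooth off the origin and absorbs the angular dependence
(`abY_radial`). Testing the weak equation this way shows that the angular coefficient `f` of index
`n` is a weak solution of the Bessel-type equation `f'' + f'/r - μ² f/r² + z f = 0` with `μ = |n +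
α|`. Bessel's inequality makes it square integrable for `r dr`.

The ODE is never solved by Bessel functions. Put `I(ρ) = ∫₀^ρ t^(μ+1) f dt`. The lemma of du
Bois-Reymond applied to `r^(-μ) f` gives the integral equation `f = c r^(-μ) + d r^μ - z r^μ ∫
ρ^(-2μ-1) I(ρ) dρ` almost everywhere (`exists_radial_representation`). A bound `I = O(r^e)` with `e
≠ 2μ` therefore yields `f = c r^(-μ) + d' r^μ + O(r^(e-μ))`.

Square integrability starts with `e = μ + 1`, and one further pass suffices. If `μ < 1`, the first
pass gives `f = O(r^(-μ))`, hence `e = 2` and error `O(r^(2-μ))`. If `μ > 1`, the term `r^(-μ)` is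
not square integrable, so `c = 0`, `f = O(r)`, `e = μ + 3` and `f = O(r^(min μ 3))`.

The modes `n = 0` (`μ = α`) and `n = -1` (`μ = 1 - α`) are the only ones with `μ < 1`; their errors
are `r^(2-α)` and `r^(1+α)`. All other modes have `μ ≥ min (2-α) (1+α)`, and the values `1` and `3`
excluded for `μ` cannot occur since `α` is not an integer. Convergence of the expansion is the `L²`
Fourier theorem on almost every circle. -/

open MeasureTheory Set Filter

/-! ### Test functions on an interval and weak derivatives. -/

/-- Smooth real functions with compact support in `(0, R)`. -/
structure IsTest (R : ℝ) (ψ : ℝ → ℝ) : Prop where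
  contDiff : ContDiff ℝ ∞ ψ
  hasCompactSupport : HasCompactSupport ψ
  tsupport_subset : tsupport ψ ⊆ Ioo 0 R

namespace IsTest

variable {R : ℝ} {ψ χ : ℝ → ℝ}

theorem of_tsupport_subset_Icc {a b : ℝ} (h : ContDiff ℝ ∞ ψ) (ha : 0 < a) (hb : b < R)
    (hs : tsupport ψ ⊆ Icc a b) : IsTest R ψ :=
  ⟨h, isCompact_Icc.of_isClosed_subset (isClosed_tsupport ψ) hs,
    hs.trans fun _ hx => ⟨ha.trans_le hx.1, hx.2.trans_lt hb⟩⟩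

theorem exists_Icc (hR : 0 < R) (h : IsTest R ψ) :
    ∃ a b, 0 < a ∧ a ≤ b ∧ b < R ∧ tsupport ψ ⊆ Icc a b := by
  rcases (tsupport ψ).eq_empty_or_nonempty with he | hne
  · exact ⟨R / 2, R / 2, by linarith, le_rfl, by linarith, by simp [he]⟩
  · obtain ⟨a, ha, ha'⟩ := h.hasCompactSupport.isCompact.exists_isLeast hne
    obtain ⟨b, hb, hb'⟩ := h.hasCompactSupport.isCompact.exists_isGreatest hne
    exact ⟨a, b, (h.tsupport_subset ha).1, ha' hb, (h.tsupport_subset hb).2,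
      fun x hx => ⟨ha' hx, hb' hx⟩⟩

theorem deriv_isTest (h : IsTest R ψ) : IsTest R (deriv ψ) :=
  ⟨(contDiff_infty_iff_deriv.1 h.contDiff).2, h.hasCompactSupport.deriv,
    (tsupport_deriv_subset (f := ψ) (𝕜 := ℝ)).trans h.tsupport_subset⟩

theorem sub_const_mul (h : IsTest R ψ) (h' : IsTest R χ) (c : ℝ) :
    IsTest R (fun x => ψ x - c * χ x) := by
  refine ⟨h.contDiff.sub (contDiff_const.mul h'.contDiff),
    h.hasCompactSupport.sub (h'.hasCompactSupport.mul_left (f := fun _ => c)), ?_⟩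
  refine (tsupport_sub ψ (fun x => c * χ x)).trans (union_subset h.tsupport_subset ?_)
  exact (tsupport_mul_subset_right (f := fun _ => c)).trans h'.tsupport_subset

theorem mul_of_contDiffOn (h : IsTest R ψ) {g : ℝ → ℝ} (hg : ContDiffOn ℝ ∞ g (Ioi 0)) :
    IsTest R (fun x => g x * ψ x) := by
  refine ⟨?_, h.hasCompactSupport.mul_left, tsupport_mul_subset_right.trans h.tsupport_subset⟩
  rw [contDiff_iff_contDiffAt]
  intro x
  by_cases hx : x ∈ tsupport ψ
  · exact (hg.contDiffAt (Ioi_mem_nhds (h.tsupport_subset hx).1)).mul h.contDiff.contDiffAt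
  · have : (fun x => g x * ψ x) =ᶠ[nhds x] fun _ => 0 := by
      filter_upwards [(isClosed_tsupport ψ).isOpen_compl.mem_nhds hx] with y hy
      simp [image_eq_zero_of_notMem_tsupport hy]
    exact contDiffAt_const.congr_of_eventuallyEq this

theorem rpow_mul (h : IsTest R ψ) (p : ℝ) : IsTest R (fun x => x ^ p * ψ x) :=
  h.mul_of_contDiffOn fun _ hx =>
    (Real.contDiffAt_rpow_const_of_ne (ne_of_gt hx)).contDiffWithinAt

theorem eq_zero_of_notMem (h : IsTest R ψ) {x : ℝ} (hx : x ∉ Ioo 0 R) : ψ x = 0 :=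
  image_eq_zero_of_notMem_tsupport fun hx' => hx (h.tsupport_subset hx')

theorem integrable_smul (h : IsTest R ψ) {v : ℝ → ℂ} (hv : LocallyIntegrableOn v (Ioo 0 R)) :
    Integrable fun x => (ψ x : ℂ) * v x := by
  have h1 : IntegrableOn v (tsupport ψ) :=
    hv.integrableOn_compact_subset h.tsupport_subset h.hasCompactSupport.isCompact
  have h2 : IntegrableOn (fun x => (ψ x : ℂ) * v x) (tsupport ψ) :=
    h1.continuousOn_mul (Complex.continuous_ofReal.comp h.contDiff.continuous).continuousOn
      h.hasCompactSupport.isCompact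
  rw [← integrableOn_univ]
  refine h2.of_forall_sdiff_eq_zero MeasurableSet.univ fun x hx => ?_
  simp [image_eq_zero_of_notMem_tsupport hx.2]

theorem integrable (h : IsTest R ψ) : Integrable ψ :=
  h.contDiff.continuous.integrable_of_hasCompactSupport h.hasCompactSupport

theorem integral_eq_intervalIntegral {E : Type*} [NormedAddCommGroup E] [NormedSpace ℝ E]
    {a b : ℝ} (hab : a ≤ b) {F : ℝ → E} (hF : ∀ x, x ∉ Icc a b → F x = 0) :
    ∫ x, F x = ∫ x in a..b, F x := by
  rw [intervalIntegral.integral_of_le hab, ← integral_Icc_eq_integral_Ioc,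
    setIntegral_eq_integral_of_forall_compl_eq_zero hF]

/-- Mean zero is exactly what makes the primitive starting at the left end of the support vanish
again to the right of it. -/
theorem exists_primitive (hR : 0 < R) (h : IsTest R χ) (h0 : ∫ x, χ x = 0) :
    ∃ ψ, IsTest R ψ ∧ deriv ψ = χ := by
  obtain ⟨a, b, ha, hab, hb, hs⟩ := h.exists_Icc hR
  have hz : ∀ x, x ∉ Icc a b → χ x = 0 := fun x hx =>
    image_eq_zero_of_notMem_tsupport fun h' => hx (hs h')
  have hc := h.contDiff.continuous
  have hd : ∀ x, HasDerivAt (fun x => ∫ t in a..x, χ t) (χ x) x := fun x =>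
    intervalIntegral.integral_hasDerivAt_right (hc.intervalIntegrable _ _)
      (hc.stronglyMeasurableAtFilter _ _) hc.continuousAt
  have hde : deriv (fun x => ∫ t in a..x, χ t) = χ := funext fun x => (hd x).deriv
  refine ⟨fun x => ∫ t in a..x, χ t, of_tsupport_subset_Icc ?_ ha hb ?_, hde⟩
  · rw [contDiff_infty_iff_deriv, hde]
    exact ⟨fun x => (hd x).differentiableAt, h.contDiff⟩
  · refine closure_minimal (fun x hx => ?_) isClosed_Icc
    by_contra hxI
    refine hx ?_
    rw [mem_Icc, not_and_or, not_le, not_le] at hxI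
    have hb0 : ∫ t in a..b, χ t = 0 := by rw [← integral_eq_intervalIntegral hab hz, h0]
    rcases hxI with hxa | hxb
    · change ∫ t in a..x, χ t = 0
      rw [intervalIntegral.integral_symm, intervalIntegral.integral_of_le hxa.le,
        integral_Ioc_eq_integral_Ioo, setIntegral_eq_zero_of_forall_eq_zero, neg_zero]
      exact fun t ht => hz t fun h' => absurd ht.2 (not_lt.2 h'.1)
    · change ∫ t in a..x, χ t = 0
      rw [← intervalIntegral.integral_add_adjacent_intervals (hc.intervalIntegrable a b)
        (hc.intervalIntegrable b x), hb0, intervalIntegral.integral_of_le hxb.le,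
        setIntegral_eq_zero_of_forall_eq_zero, add_zero]
      exact fun t ht => hz t fun h' => absurd ht.1 (not_lt.2 h'.2)

theorem exists_integral_eq_one (hR : 0 < R) : ∃ ρ, IsTest R ρ ∧ ∫ x, ρ x = 1 := by
  let f : ContDiffBump (R / 2) := ⟨R / 8, R / 4, by linarith, by linarith⟩
  refine ⟨f.normed volume, of_tsupport_subset_Icc (a := R / 4) (b := 3 * R / 4)
    f.contDiff_normed (by linarith) (by linarith) ?_, f.integral_normed⟩
  rw [f.tsupport_normed_eq, Real.closedBall_eq_Icc]
  exact Icc_subset_Icc (by simp only [f]; linarith) (by simp only [f]; linarith)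

end IsTest

/-- The lemma of du Bois-Reymond. -/
theorem ae_eq_const_of_integral_deriv_mul_eq_zero {R : ℝ} (hR : 0 < R) {v : ℝ → ℂ}
    (hv : LocallyIntegrableOn v (Ioo 0 R))
    (h : ∀ ξ, IsTest R ξ → ∫ x, ((deriv ξ x : ℝ) : ℂ) * v x = 0) :
    ∃ K : ℂ, ∀ᵐ x, x ∈ Ioo 0 R → v x = K := by
  obtain ⟨ρ, hρ, hρ1⟩ := IsTest.exists_integral_eq_one hR
  refine ⟨∫ x, (ρ x : ℂ) * v x, ?_⟩
  set K := ∫ x, (ρ x : ℂ) * v x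
  have hvK : LocallyIntegrableOn (fun x => v x - K) (Ioo 0 R) :=
    hv.sub (locallyIntegrableOn_const K)
  -- For an arbitrary test function `g`, the difference `g - (∫ g) ρ` has mean zero, so it is the
  -- derivative of a test function.
  suffices key : ∀ g : ℝ → ℝ, ContDiff ℝ ∞ g → HasCompactSupport g → tsupport g ⊆ Ioo 0 R →
      ∫ x, g x • (v x - K) = 0 by
    filter_upwards [isOpen_Ioo.ae_eq_zero_of_integral_contDiff_smul_eq_zero hvK key]
      with x hx hxI using sub_eq_zero.1 (hx hxI)
  · intro g h1 h2 h3
    have hg : IsTest R g := ⟨h1, h2, h3⟩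
    obtain ⟨ξ, hξ, hξd⟩ := (hg.sub_const_mul hρ (∫ x, g x)).exists_primitive hR (by
      rw [integral_sub hg.integrable (hρ.integrable.const_mul _), integral_const_mul, hρ1]; simp)
    have h4 := h ξ hξ
    rw [hξd] at h4
    have h5 : ∀ x, ((g x - (∫ x, g x) * ρ x : ℝ) : ℂ) * v x
        = (g x : ℂ) * v x - (∫ x, g x : ℝ) * ((ρ x : ℂ) * v x) := fun x => by push_cast; ring
    simp_rw [h5] at h4
    rw [integral_sub (hg.integrable_smul hv) ((hρ.integrable_smul hv).const_mul _),
      integral_const_mul] at h4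
    have h6 : ∀ x, g x • (v x - K) = (g x : ℂ) * v x - (g x : ℂ) * K := fun x => by
      rw [Complex.real_smul]; ring
    simp_rw [h6]
    rw [integral_sub (hg.integrable_smul hv) (hg.integrable_smul (locallyIntegrableOn_const K)),
      integral_mul_const, integral_complex_ofReal, h4]

/-- Integration by parts when `k` is merely integrable: Fubini on the triangle `y ≤ x`, followed by
the fundamental theorem for `ξ`. The boundary term at `a` is absent because the primitive starts
there. -/
theorem integral_deriv_mul_primitive {a b : ℝ} (hab : a ≤ b) {k : ℝ → ℂ}
    (hk : IntervalIntegrable k volume a b) {ξ : ℝ → ℝ} (hξ : ContDiff ℝ 1 ξ) (hb : ξ b = 0) :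
    ∫ x in a..b, ((deriv ξ x : ℝ) : ℂ) * ∫ y in a..x, k y = -∫ y in a..b, (ξ y : ℂ) * k y := by
  have hc : Continuous (deriv ξ) := hξ.continuous_deriv le_rfl
  have h1 : ∀ x ∈ uIcc a b, ((deriv ξ x : ℝ) : ℂ) * ∫ y in a..x, k y
      = ∫ y in a..b, ((deriv ξ x : ℝ) : ℂ) * (Iic x).indicator k y := by
    intro x hx
    rw [uIcc_of_le hab] at hx
    rw [intervalIntegral.integral_const_mul, intervalIntegral.integral_of_le hx.1,
      intervalIntegral.integral_of_le hab, setIntegral_indicator measurableSet_Iic,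
      Ioc_inter_Iic, min_eq_right hx.2]
  have hI : Integrable (Function.uncurry fun x y => ((deriv ξ x : ℝ) : ℂ) * (Iic x).indicator k y)
      ((volume.restrict (Ioc a b)).prod (volume.restrict (Ioc a b))) := by
    have h2 : Integrable (fun p : ℝ × ℝ => ((deriv ξ p.1 : ℝ) : ℂ) * k p.2)
        ((volume.restrict (Ioc a b)).prod (volume.restrict (Ioc a b))) := by
      refine Integrable.mul_prod (f := fun x => ((deriv ξ x : ℝ) : ℂ)) ?_ ?_
      · exact (Complex.continuous_ofReal.comp hc).integrableOn_Ioc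
      · rwa [intervalIntegrable_iff_integrableOn_Ioc_of_le hab] at hk
    have h3 : (Function.uncurry fun x y => ((deriv ξ x : ℝ) : ℂ) * (Iic x).indicator k y)
        = {p : ℝ × ℝ | p.2 ≤ p.1}.indicator (fun p : ℝ × ℝ => ((deriv ξ p.1 : ℝ) : ℂ) * k p.2) := by
      ext ⟨x, y⟩
      by_cases h : y ≤ x <;> simp [indicator, h]
    rw [h3]
    exact h2.indicator (measurableSet_le measurable_snd measurable_fst)
  rw [intervalIntegral.integral_congr h1, intervalIntegral_intervalIntegral_swap,
    ← intervalIntegral.integral_neg]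
  · refine intervalIntegral.integral_congr fun y hy => ?_
    rw [uIcc_of_le hab] at hy
    have h4 : ∀ x, ((deriv ξ x : ℝ) : ℂ) * (Iic x).indicator k y
        = (Ici y).indicator (fun x => ((deriv ξ x : ℝ) : ℂ) * k y) x := fun x => by
      by_cases h : y ≤ x <;> simp [indicator, h]
    simp_rw [h4]
    rw [intervalIntegral.integral_of_le hab, ← integral_Icc_eq_integral_Ioc,
      setIntegral_indicator measurableSet_Ici]
    have h5 : Icc a b ∩ Ici y = Icc y b := by
      ext x; simp only [mem_inter_iff, mem_Icc, mem_Ici]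
      exact ⟨fun h => ⟨h.2, h.1.2⟩, fun h => ⟨⟨hy.1.trans h.1, h.2⟩, h.1⟩⟩
    rw [h5, integral_Icc_eq_integral_Ioc, integral_mul_const, integral_complex_ofReal,
      ← intervalIntegral.integral_of_le hy.2,
      intervalIntegral.integral_deriv_eq_sub (fun x _ => (hξ.differentiable one_ne_zero) x)
        (hc.intervalIntegrable _ _), hb]
    push_cast; ring
  · rw [uIoc_of_le hab, IntegrableOn, Measure.volume_eq_prod, ← Measure.prod_restrict]
    exact hI

theorem IsTest.integral_deriv_mul_primitive {R : ℝ} {ξ : ℝ → ℝ} (hξ : IsTest R ξ) {k : ℝ → ℂ}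
    {r₀ : ℝ} (hr₀ : r₀ ∈ Ioo 0 R) (hk : LocallyIntegrableOn k (Ioo 0 R)) :
    ∫ x, ((deriv ξ x : ℝ) : ℂ) * ∫ y in r₀..x, k y = -∫ y, (ξ y : ℂ) * k y := by
  have hR : 0 < R := hr₀.1.trans hr₀.2
  obtain ⟨a, b, ha, hab, hb, hs⟩ := hξ.exists_Icc hR
  -- A right endpoint strictly beyond the support, where `ξ` certainly vanishes.
  obtain ⟨b', hbb, hb'⟩ := exists_between hb
  have hz : ∀ x, x ∉ Icc a b → ξ x = 0 := fun x hx =>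
    image_eq_zero_of_notMem_tsupport fun h' => hx (hs h')
  have hz' : ∀ x, x ∉ Icc a b → deriv ξ x = 0 := fun x hx =>
    image_eq_zero_of_notMem_tsupport fun h' => hx (hs (tsupport_deriv_subset (𝕜 := ℝ) h'))
  have hs' : Icc a b ⊆ Icc a b' := Icc_subset_Icc_right hbb.le
  have hab' : a ≤ b' := hab.trans hbb.le
  have hi : ∀ {x y}, x ∈ Ioo 0 R → y ∈ Ioo 0 R → IntervalIntegrable k volume x y := by
    intro x y hx hy
    exact (hk.integrableOn_compact_subset (ordConnected_Ioo.uIcc_subset hx hy)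
      isCompact_uIcc).intervalIntegrable
  have haI : a ∈ Ioo 0 R := ⟨ha, hab.trans_lt hb⟩
  have hbI : b' ∈ Ioo 0 R := ⟨ha.trans_le hab', hb'⟩
  rw [IsTest.integral_eq_intervalIntegral hab' (F := fun x => ((deriv ξ x : ℝ) : ℂ) * ∫ y in r₀..x, k y)
    (fun x hx => by simp [hz' x fun h => hx (hs' h)]),
    IsTest.integral_eq_intervalIntegral hab' (F := fun y => (ξ y : ℂ) * k y)
    (fun x hx => by simp [hz x fun h => hx (hs' h)]),
    ← _root_.integral_deriv_mul_primitive hab' (hi haI hbI)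
      (hξ.contDiff.of_le (by exact_mod_cast le_top)) (hz b' fun h => absurd h.2 (not_le.2 hbb))]
  have hc : Continuous (deriv ξ) := hξ.deriv_isTest.contDiff.continuous
  -- Moving the base point from `r₀` to `a` adds a constant to the primitive, which is annihilated
  -- by `∫ ξ' = 0`.
  have h1 : ∀ x ∈ uIcc a b', ((deriv ξ x : ℝ) : ℂ) * ∫ y in r₀..x, k y
      = ((deriv ξ x : ℝ) : ℂ) * (∫ y in r₀..a, k y) + ((deriv ξ x : ℝ) : ℂ) * ∫ y in a..x, k y := by
    intro x hx
    rw [uIcc_of_le hab'] at hx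
    rw [← mul_add, intervalIntegral.integral_add_adjacent_intervals (hi hr₀ haI)
      (hi haI ⟨ha.trans_le hx.1, hx.2.trans_lt hb'⟩)]
  rw [intervalIntegral.integral_congr h1, intervalIntegral.integral_add,
    intervalIntegral.integral_mul_const, intervalIntegral.integral_ofReal,
    intervalIntegral.integral_deriv_eq_sub
      (fun x _ => (hξ.contDiff.differentiable (by simp)) x) (hc.intervalIntegrable _ _),
    hz b' fun h => absurd h.2 (not_le.2 hbb)]
  · have : ξ a = 0 := by
      by_contra hne
      have h2 : ∀ᶠ x in nhds a, ξ x ≠ 0 := hξ.contDiff.continuous.continuousAt.eventually_ne hne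
      obtain ⟨x, hx, hx'⟩ := ((h2.filter_mono nhdsWithin_le_nhds).and
        (self_mem_nhdsWithin (s := Iio a))).exists
      exact hx (hz x fun h => absurd hx' (not_lt.2 h.1))
    simp [this]
  · exact ((Complex.continuous_ofReal.comp hc).mul continuous_const).intervalIntegrable _ _
  · refine ContinuousOn.intervalIntegrable ?_
    refine (Complex.continuous_ofReal.comp hc).continuousOn.mul ?_
    refine intervalIntegral.continuousOn_primitive_interval' ?_ left_mem_uIcc
    exact hi haI hbI

/-! ### Variation of constants for the radial equation. -/

theorem continuousOn_ofReal_rpow (p : ℝ) (R : ℝ) :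
    ContinuousOn (fun r : ℝ => ((r ^ p : ℝ) : ℂ)) (Ioo 0 R) :=
  Complex.continuous_ofReal.comp_continuousOn
    (continuousOn_id.rpow_const fun _ hx => Or.inl (ne_of_gt hx.1))

/-- The moment `∫₀^ρ t^{μ+1} f(t) dt` of a radial function. -/
noncomputable def radialMoment (μ : ℝ) (f : ℝ → ℂ) (ρ : ℝ) : ℂ :=
  ∫ t in (0 : ℝ)..ρ, ((t ^ (μ + 1) : ℝ) : ℂ) * f t

section Moment

variable {R μ : ℝ} {f : ℝ → ℂ}

theorem intervalIntegrable_moment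
    (hf : IntegrableOn (fun t => ((t ^ (μ + 1) : ℝ) : ℂ) * f t) (Ioo 0 R)) {x y : ℝ}
    (hx : 0 ≤ x) (hy : 0 ≤ y) (hx' : x < R) (hy' : y < R) :
    IntervalIntegrable (fun t => ((t ^ (μ + 1) : ℝ) : ℂ) * f t) volume x y := by
  rw [intervalIntegrable_iff]
  refine hf.mono_set fun t ht => ?_
  rw [uIoc, mem_Ioc] at ht
  exact ⟨(le_min hx hy).trans_lt ht.1, ht.2.trans_lt (max_lt hx' hy')⟩

theorem radialMoment_eq_add
    (hf : IntegrableOn (fun t => ((t ^ (μ + 1) : ℝ) : ℂ) * f t) (Ioo 0 R)) {x y : ℝ}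
    (hx : x ∈ Ioo 0 R) (hy : y ∈ Ioo 0 R) :
    radialMoment μ f y =
      radialMoment μ f x + ∫ t in x..y, ((t ^ (μ + 1) : ℝ) : ℂ) * f t := by
  have h0 : (0 : ℝ) < R := hx.1.trans hx.2
  rw [radialMoment, radialMoment, intervalIntegral.integral_add_adjacent_intervals
    (intervalIntegrable_moment hf le_rfl hx.1.le h0 hx.2)
    (intervalIntegrable_moment hf hx.1.le hy.1.le hx.2 hy.2)]

theorem continuousOn_radialMoment
    (hf : IntegrableOn (fun t => ((t ^ (μ + 1) : ℝ) : ℂ) * f t) (Ioo 0 R)) :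
    ContinuousOn (radialMoment μ f) (Ioo 0 R) := by
  intro x hx
  obtain ⟨b, hxb, hb⟩ := exists_between hx.2
  have h0 : (0 : ℝ) < b := hx.1.trans hxb
  have h1 : ContinuousOn (radialMoment μ f) (uIcc 0 b) :=
    intervalIntegral.continuousOn_primitive_interval'
      (intervalIntegrable_moment hf le_rfl h0.le (h0.trans hb) hb) left_mem_uIcc
  rw [uIcc_of_le h0.le] at h1
  exact (h1.continuousAt (Icc_mem_nhds hx.1 hxb)).continuousWithinAt

end Moment

theorem IsTest.rpow_mul_cancel {R : ℝ} {ξ : ℝ → ℝ} (hξ : IsTest R ξ) (p q : ℝ) (hpq : p + q = 0)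
    (r : ℝ) : r ^ p * (r ^ q * ξ r) = ξ r := by
  by_cases hr : r ∈ Ioo 0 R
  · rw [← mul_assoc, ← Real.rpow_add hr.1, hpq, Real.rpow_zero, one_mul]
  · simp [hξ.eq_zero_of_notMem hr]

/-- Variation of constants for weak solutions of `f'' + f'/r - μ² f/r² + z f = 0` on `(0, R)`. -/
theorem exists_radial_representation {R μ : ℝ} (hR : 0 < R) (hμ : 0 < μ) {z : ℂ} {f : ℝ → ℂ}
    (hf : IntegrableOn (fun t => ((t ^ (μ + 1) : ℝ) : ℂ) * f t) (Ioo 0 R))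
    (H : ∀ ψ, IsTest R ψ →
      ∫ r, (((r ^ (-μ) * deriv (fun r => r ^ (2 * μ + 1) * deriv ψ r) r : ℝ) : ℂ)
        + z * ((r ^ (μ + 1) * ψ r : ℝ) : ℂ)) * f r = 0) :
    ∃ c d : ℂ, ∀ᵐ r, r ∈ Ioo 0 R → f r = c * ((r ^ (-μ) : ℝ) : ℂ) + d * ((r ^ μ : ℝ) : ℂ)
      - z * ((r ^ μ : ℝ) : ℂ) *
        ∫ ρ in (R / 2)..r, ((ρ ^ (-2 * μ - 1) : ℝ) : ℂ) * radialMoment μ f ρ := by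
  set r₀ := R / 2
  have hr₀ : r₀ ∈ Ioo 0 R := ⟨by positivity, half_lt_self hR⟩
  set k : ℝ → ℂ := fun t => ((t ^ (μ + 1) : ℝ) : ℂ) * f t with hk_def
  set w : ℝ → ℂ := fun t => ((t ^ (-μ) : ℝ) : ℂ) * f t with hw_def
  set J : ℝ → ℂ := fun ρ => ((ρ ^ (-2 * μ - 1) : ℝ) : ℂ) * radialMoment μ f ρ with hJ_def
  set σ : ℝ → ℂ := fun ρ => ((ρ ^ (-2 * μ - 1) : ℝ) : ℂ) with hσ_def
  have hk : LocallyIntegrableOn k (Ioo 0 R) := hf.locallyIntegrableOn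
  have hσc : ContinuousOn σ (Ioo 0 R) := continuousOn_ofReal_rpow _ R
  have hσ : LocallyIntegrableOn σ (Ioo 0 R) := hσc.locallyIntegrableOn measurableSet_Ioo
  have hJc : ContinuousOn J (Ioo 0 R) := hσc.mul (continuousOn_radialMoment hf)
  have hJ : LocallyIntegrableOn J (Ioo 0 R) := hJc.locallyIntegrableOn measurableSet_Ioo
  have hw : LocallyIntegrableOn w (Ioo 0 R) := by
    have h1 : LocallyIntegrableOn (fun t => σ t * k t) (Ioo 0 R) :=
      hk.continuousOn_mul hσc isOpen_Ioo.isLocallyClosed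
    refine h1.congr ?_
    filter_upwards [ae_restrict_mem measurableSet_Ioo] with t ht
    simp only [hσ_def, hk_def, hw_def]
    rw [← mul_assoc, ← Complex.ofReal_mul, ← Real.rpow_add ht.1]
    ring_nf
  have hJσ : ∀ x, J x = σ x * radialMoment μ f x := fun x => rfl
  -- Choose `ψ` with `r^(2μ+1) ψ' = ξ`; it is a test function exactly because `∫ ξ σ = 0`. The term
  -- in `z` is then integrated by parts, which produces the moment.
  have step1 : ∀ ξ, IsTest R ξ → ∫ x, (ξ x : ℂ) * σ x = 0 →
      ∫ x, ((deriv ξ x : ℝ) : ℂ) * w x = z * ∫ x, (ξ x : ℂ) * J x := by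
    intro ξ hξ h0
    have hχ := hξ.rpow_mul (-2 * μ - 1)
    set χ : ℝ → ℝ := fun x => x ^ (-2 * μ - 1) * ξ x with hχ_def
    have hχ0 : ∫ x, χ x = 0 := by
      rw [← Complex.ofReal_inj, ← integral_complex_ofReal, Complex.ofReal_zero, ← h0]
      congr 1; ext x; simp only [hχ_def, hσ_def]; push_cast; ring
    obtain ⟨ψ, hψ, hψd⟩ := hχ.exists_primitive hR hχ0
    have h1 := H ψ hψ
    have h2 : (fun r => r ^ (2 * μ + 1) * deriv ψ r) = ξ := by
      ext r
      rw [hψd]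
      exact hξ.rpow_mul_cancel _ _ (by ring) r
    rw [h2] at h1
    have h3 : ∀ r, (((r ^ (-μ) * deriv ξ r : ℝ) : ℂ) + z * ((r ^ (μ + 1) * ψ r : ℝ) : ℂ)) * f r
        = ((deriv ξ r : ℝ) : ℂ) * w r + z * ((ψ r : ℂ) * k r) := fun r => by
      simp only [hw_def, hk_def]; push_cast; ring
    simp_rw [h3] at h1
    rw [integral_add (hξ.deriv_isTest.integrable_smul hw) ((hψ.integrable_smul hk).const_mul z),
      integral_const_mul] at h1
    have h4 := hψ.integral_deriv_mul_primitive hr₀ hk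
    rw [hψd] at h4
    have h5 : ∀ x, (χ x : ℂ) * ∫ y in r₀..x, k y
        = (ξ x : ℂ) * J x - (χ x : ℂ) * radialMoment μ f r₀ := by
      intro x
      by_cases hx : x ∈ Ioo 0 R
      · have h7 := radialMoment_eq_add hf hr₀ hx
        rw [hJσ, h7]
        simp only [hχ_def, hσ_def, hk_def]; push_cast; ring
      · simp [hχ_def, hξ.eq_zero_of_notMem hx]
    simp_rw [h5] at h4
    rw [integral_sub (hξ.integrable_smul hJ) (hχ.integrable_smul (locallyIntegrableOn_const _)),
      integral_mul_const, integral_complex_ofReal, hχ0] at h4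
    simp only [Complex.ofReal_zero, zero_mul, sub_zero] at h4
    rw [h4]
    linear_combination h1
  obtain ⟨P₀, hP₀, hP₀1⟩ := IsTest.exists_integral_eq_one hR
  have hP := hP₀.rpow_mul (2 * μ + 1)
  set P : ℝ → ℝ := fun x => x ^ (2 * μ + 1) * P₀ x with hP_def
  have hPσ : ∫ x, (P x : ℂ) * σ x = 1 := by
    rw [← Complex.ofReal_one, ← hP₀1, ← integral_complex_ofReal]
    congr 1; ext x
    rw [← hP₀.rpow_mul_cancel (-2 * μ - 1) (2 * μ + 1) (by ring) x]
    simp only [hP_def, hσ_def]; push_cast; ring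
  -- A Lagrange multiplier for the constraint `∫ ξ σ = 0`: subtracting `(∫ ξ σ) P` from `ξ` enforces
  -- it, and the error is proportional to `∫ ξ σ`. Thus `w' = -(z J + C σ)` in the weak sense.
  set C : ℂ := (∫ x, ((deriv P x : ℝ) : ℂ) * w x) - z * ∫ x, (P x : ℂ) * J x with hC
  have step2 : ∀ ξ, IsTest R ξ →
      ∫ x, ((deriv ξ x : ℝ) : ℂ) * w x = z * (∫ x, (ξ x : ℂ) * J x) + C * ∫ x, (ξ x : ℂ) * σ x := by
    intro ξ hξ
    set c : ℝ := ∫ x, ξ x * x ^ (-2 * μ - 1) with hc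
    have hcσ : ∫ x, (ξ x : ℂ) * σ x = c := by
      rw [hc, ← integral_complex_ofReal]; simp only [hσ_def]; push_cast; rfl
    have e1 : ∀ v : ℝ → ℂ, ∀ x, ((ξ x - c * P x : ℝ) : ℂ) * v x
        = (ξ x : ℂ) * v x - c * ((P x : ℂ) * v x) := fun v x => by push_cast; ring
    have e2 : ∀ v : ℝ → ℂ, LocallyIntegrableOn v (Ioo 0 R) →
        ∫ x, ((ξ x - c * P x : ℝ) : ℂ) * v x
          = (∫ x, (ξ x : ℂ) * v x) - c * ∫ x, (P x : ℂ) * v x := fun v hv => by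
      simp_rw [e1 v]
      rw [integral_sub (hξ.integrable_smul hv) ((hP.integrable_smul hv).const_mul _),
        integral_const_mul]
    have h1 := step1 _ (hξ.sub_const_mul hP c) (by rw [e2 σ hσ, hPσ, hcσ]; ring)
    have e3 : ∀ x, ((deriv (fun x => ξ x - c * P x) x : ℝ) : ℂ) * w x
        = ((deriv ξ x : ℝ) : ℂ) * w x - c * (((deriv P x : ℝ) : ℂ) * w x) := fun x => by
      have d1 : DifferentiableAt ℝ ξ x := (hξ.contDiff.differentiable (by simp)) x
      have d2 : DifferentiableAt ℝ P x := (hP.contDiff.differentiable (by simp)) x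
      rw [deriv_fun_sub d1 (d2.const_mul c), deriv_const_mul _ d2]
      push_cast; ring
    simp_rw [e3] at h1
    rw [e2 J hJ, integral_sub (hξ.deriv_isTest.integrable_smul hw)
      ((hP.deriv_isTest.integrable_smul hw).const_mul _), integral_const_mul] at h1
    rw [hcσ, hC]
    linear_combination h1
  set g : ℝ → ℂ := fun x => z * J x + C * σ x with hg_def
  have hgc : ContinuousOn g (Ioo 0 R) :=
    (continuousOn_const.mul hJc).add (continuousOn_const.mul hσc)
  have hg : LocallyIntegrableOn g (Ioo 0 R) := hgc.locallyIntegrableOn measurableSet_Ioo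
  have hii : ∀ {v : ℝ → ℂ}, ContinuousOn v (Ioo 0 R) → ∀ x ∈ Ioo 0 R,
      IntervalIntegrable v volume r₀ x := fun hv x hx =>
    (hv.mono (ordConnected_Ioo.uIcc_subset hr₀ hx)).intervalIntegrable
  have hB : LocallyIntegrableOn (fun x => ∫ y in r₀..x, g y) (Ioo 0 R) := by
    refine ContinuousOn.locallyIntegrableOn (fun x hx => ?_) measurableSet_Ioo
    exact (intervalIntegral.integral_hasDerivAt_right (hii hgc x hx)
      (hgc.stronglyMeasurableAtFilter isOpen_Ioo x hx)
      (hgc.continuousAt (isOpen_Ioo.mem_nhds hx))).continuousAt.continuousWithinAt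
  obtain ⟨K, hK⟩ := ae_eq_const_of_integral_deriv_mul_eq_zero hR (hw.add hB) (fun ξ hξ => by
    simp only [Pi.add_apply, mul_add]
    rw [integral_add (hξ.deriv_isTest.integrable_smul hw) (hξ.deriv_isTest.integrable_smul hB),
      hξ.integral_deriv_mul_primitive hr₀ hg, step2 ξ hξ]
    have e1 : ∀ x, (ξ x : ℂ) * g x = z * ((ξ x : ℂ) * J x) + C * ((ξ x : ℂ) * σ x) := fun x => by
      simp only [hg_def]; ring
    simp_rw [e1]
    rw [integral_add ((hξ.integrable_smul hJ).const_mul _) ((hξ.integrable_smul hσ).const_mul _),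
      integral_const_mul, integral_const_mul]
    ring)
  -- Both constants come from `w = K - ∫ g` together with `∫ σ = (r^(-2μ) - r₀^(-2μ)) / (-2μ)`,
  -- after multiplication by `r^μ`.
  refine ⟨C / (2 * μ), K - C * (r₀ ^ (-2 * μ) : ℝ) / (2 * μ), ?_⟩
  filter_upwards [hK] with r hr hrI
  have h1 := hr hrI
  have h2 : ∫ y in r₀..r, g y = z * (∫ y in r₀..r, J y)
      + C * (((r ^ (-2 * μ) - r₀ ^ (-2 * μ)) / (-2 * μ) : ℝ) : ℂ) := by
    simp only [hg_def]
    rw [intervalIntegral.integral_add ((hii hJc r hrI).const_mul _) ((hii hσc r hrI).const_mul _),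
      intervalIntegral.integral_const_mul, intervalIntegral.integral_const_mul]
    simp only [hσ_def]
    rw [intervalIntegral.integral_ofReal, integral_rpow]
    · ring_nf
    · right
      exact ⟨by linarith, fun h => absurd ((ordConnected_Ioo.uIcc_subset hr₀ hrI) h).1 (lt_irrefl _)⟩
  simp only [Pi.add_apply, h2, hw_def] at h1
  have h3 : f r = ((r ^ μ : ℝ) : ℂ) * (((r ^ (-μ) : ℝ) : ℂ) * f r) := by
    rw [← mul_assoc, ← Complex.ofReal_mul, ← Real.rpow_add hrI.1]; simp
  have h4 : ((r ^ (-μ) : ℝ) : ℂ) = ((r ^ μ : ℝ) : ℂ) * ((r ^ (-2 * μ) : ℝ) : ℂ) := by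
    rw [← Complex.ofReal_mul, ← Real.rpow_add hrI.1]; ring_nf
  have hμ' : (μ : ℂ) ≠ 0 := by exact_mod_cast hμ.ne'
  rw [eq_sub_of_add_eq h1] at h3
  rw [h3, h4]
  push_cast
  field_simp
  ring

/-! ### Asymptotics of radial solutions at the origin. -/

theorem rpow_isBigO_rpow_zero {p q : ℝ} (h : q ≤ p) :
    (fun r : ℝ => r ^ p) =O[nhdsWithin 0 (Ioi 0)] fun r : ℝ => r ^ q := by
  refine Asymptotics.IsBigO.of_bound 1 ?_
  filter_upwards [Ioo_mem_nhdsGT (zero_lt_one' ℝ)] with r hr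
  rw [Real.norm_of_nonneg (Real.rpow_nonneg hr.1.le _),
    Real.norm_of_nonneg (Real.rpow_nonneg hr.1.le _), one_mul]
  exact Real.rpow_le_rpow_of_exponent_ge hr.1 hr.2.le h

theorem const_mul_rpow_isBigO_rpow_zero (c : ℂ) {p q : ℝ} (h : q ≤ p) :
    (fun r : ℝ => c * ((r ^ p : ℝ) : ℂ)) =O[nhdsWithin 0 (Ioi 0)] fun r : ℝ => r ^ q := by
  refine Asymptotics.IsBigO.const_mul_left ?_ c
  refine Asymptotics.IsBigO.trans (Asymptotics.isBigO_of_le _ fun r => ?_)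
    (rpow_isBigO_rpow_zero h)
  rw [Complex.norm_real]

theorem isBigO_rpow_mul {g : ℝ → ℂ} {p q s : ℝ} (hs : p + q = s)
    (h : g =O[nhdsWithin 0 (Ioi 0)] fun r : ℝ => r ^ q) :
    (fun r : ℝ => ((r ^ p : ℝ) : ℂ) * g r) =O[nhdsWithin 0 (Ioi 0)] fun r : ℝ => r ^ s := by
  have h1 : (fun r : ℝ => ((r ^ p : ℝ) : ℂ)) =O[nhdsWithin 0 (Ioi 0)] fun r : ℝ => r ^ p :=
    Asymptotics.isBigO_of_le _ fun r => by rw [Complex.norm_real]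
  refine (h1.mul h).congr' EventuallyEq.rfl ?_
  filter_upwards [self_mem_nhdsWithin] with r hr
  rw [← Real.rpow_add hr, hs]

theorem exists_bound_of_isBigO_rpow {g : ℝ → ℂ} {q R : ℝ} (hR : 0 < R)
    (h : g =O[nhdsWithin 0 (Ioi 0)] fun r : ℝ => r ^ q) :
    ∃ C δ, 0 < C ∧ 0 < δ ∧ δ < R ∧ ∀ r, 0 < r → r ≤ δ → ‖g r‖ ≤ C * r ^ q := by
  obtain ⟨C, hC, hb⟩ := h.exists_pos
  rw [Asymptotics.isBigOWith_iff] at hb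
  obtain ⟨ε, hε, hb⟩ := mem_nhdsGT_iff_exists_Ioo_subset.1 hb
  have hε : 0 < ε := hε
  refine ⟨C, min ε R / 2, hC, by positivity, by linarith [min_le_right ε R], fun r h0 h1 => ?_⟩
  have h2 : r ∈ Ioo 0 ε := ⟨h0, by linarith [min_le_left ε R, lt_min hε hR]⟩
  have h3 := hb h2
  rwa [mem_ofPred_eq, Real.norm_of_nonneg (Real.rpow_nonneg h0.le _)] at h3

theorem exists_primitive_sub_const_isBigO {R q : ℝ} {g : ℝ → ℂ}
    (hg : ContinuousOn g (Ioo 0 R)) (hO : g =O[nhdsWithin 0 (Ioi 0)] fun r : ℝ => r ^ q)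
    (hq : q ≠ -1) {r₀ : ℝ} (hr₀ : r₀ ∈ Ioo 0 R) :
    ∃ d : ℂ, (fun r => (∫ ρ in r₀..r, g ρ) - d) =O[nhdsWithin 0 (Ioi 0)]
      fun r : ℝ => r ^ (q + 1) := by
  obtain ⟨C, δ, hC, hδ, hδR, hb⟩ := exists_bound_of_isBigO_rpow (hr₀.1.trans hr₀.2) hO
  have hii : ∀ {x y}, x ∈ Ioo 0 R → y ∈ Ioo 0 R → IntervalIntegrable g volume x y :=
    fun hx hy => (hg.mono (ordConnected_Ioo.uIcc_subset hx hy)).intervalIntegrable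
  have hδI : δ ∈ Ioo 0 R := ⟨hδ, hδR⟩
  rcases lt_or_gt_of_ne hq with hq | hq
  -- For `q < -1` the comparison function blows up, so the value of the constant is immaterial; this
  -- one removes the part of the integral away from `0`.
  · refine ⟨∫ ρ in r₀..δ, g ρ, Asymptotics.IsBigO.of_bound (C / -(q + 1)) ?_⟩
    filter_upwards [Ioo_mem_nhdsGT hδ] with r hr
    have hrI : r ∈ Ioo 0 R := ⟨hr.1, hr.2.trans hδR⟩
    have h0 : (0 : ℝ) ∉ uIcc r δ := fun h =>
      absurd ((ordConnected_Ioo.uIcc_subset hrI hδI) h).1 (lt_irrefl _)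
    rw [← intervalIntegral.integral_add_adjacent_intervals (hii hr₀ hδI) (hii hδI hrI),
      add_sub_cancel_left, intervalIntegral.integral_symm, norm_neg,
      Real.norm_of_nonneg (Real.rpow_nonneg hr.1.le _)]
    calc ‖∫ ρ in r..δ, g ρ‖ ≤ ∫ ρ in r..δ, C * ρ ^ q := by
          refine intervalIntegral.norm_integral_le_of_norm_le hr.2.le
            (ae_of_all _ fun t ht => hb t (hr.1.trans ht.1) ht.2) ?_
          exact (intervalIntegral.intervalIntegrable_rpow (Or.inr h0)).const_mul C
      _ = C * ((δ ^ (q + 1) - r ^ (q + 1)) / (q + 1)) := by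
          rw [intervalIntegral.integral_const_mul, integral_rpow (Or.inr ⟨hq.ne, h0⟩)]
      _ = C / -(q + 1) * (r ^ (q + 1) - δ ^ (q + 1)) := by
          have : q + 1 ≠ 0 := by linarith
          field_simp
          ring
      _ ≤ C / -(q + 1) * r ^ (q + 1) := by
          have h1 : 0 < -(q + 1) := by linarith
          have h2 := Real.rpow_nonneg hδ.le (q + 1)
          gcongr
          linarith
  -- For `q > -1` the integral converges at `0`, and the constant must be its limit `∫ ρ in r₀..0, g
  -- ρ`.
  · have h0δ : IntervalIntegrable g volume 0 δ := by
      have h1 : IntervalIntegrable (fun ρ : ℝ => C * ρ ^ q) volume 0 δ :=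
        (intervalIntegral.intervalIntegrable_rpow' hq).const_mul C
      rw [intervalIntegrable_iff_integrableOn_Ioc_of_le hδ.le] at h1 ⊢
      refine Integrable.mono' h1 ?_ ?_
      · exact (hg.mono fun x hx => ⟨hx.1, hx.2.trans_lt hδR⟩).aestronglyMeasurable
          measurableSet_Ioc
      · filter_upwards [ae_restrict_mem measurableSet_Ioc] with t ht using hb t ht.1 ht.2
    refine ⟨(∫ ρ in r₀..δ, g ρ) + ∫ ρ in δ..0, g ρ,
      Asymptotics.IsBigO.of_bound (C / (q + 1)) ?_⟩
    filter_upwards [Ioo_mem_nhdsGT hδ] with r hr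
    have hrI : r ∈ Ioo 0 R := ⟨hr.1, hr.2.trans hδR⟩
    have h0r : IntervalIntegrable g volume 0 r := h0δ.trans (hii hδI hrI)
    rw [← intervalIntegral.integral_add_adjacent_intervals (hii hr₀ hδI) (hii hδI hrI),
      ← intervalIntegral.integral_add_adjacent_intervals h0δ.symm h0r, add_sub_add_left_eq_sub,
      add_sub_cancel_left, Real.norm_of_nonneg (Real.rpow_nonneg hr.1.le _)]
    calc ‖∫ ρ in (0 : ℝ)..r, g ρ‖ ≤ ∫ ρ in (0 : ℝ)..r, C * ρ ^ q := by
          refine intervalIntegral.norm_integral_le_of_norm_le hr.1.le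
            (ae_of_all _ fun t ht => hb t ht.1 (ht.2.trans hr.2.le)) ?_
          exact (intervalIntegral.intervalIntegrable_rpow' hq).const_mul C
      _ = C / (q + 1) * r ^ (q + 1) := by
          rw [intervalIntegral.integral_const_mul, integral_rpow (Or.inl hq),
            Real.zero_rpow (by linarith)]
          ring

/-- A pointwise substitute for Cauchy-Schwarz: `x ≤ (1/ρ + ρ x²)/2` combined with `t^μ ≤ ρ^μ` and `t
≤ ρ`. Taking `ρ = R` gives integrability of the moment, and taking `ρ` as the upper limit gives its
decay. -/
theorem rpow_succ_mul_le {μ t ρ x : ℝ} (hμ : 0 < μ) (ht : 0 < t) (htρ : t ≤ ρ) :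
    t ^ (μ + 1) * x ≤ (ρ ^ μ + ρ ^ (μ + 1) * (x ^ 2 * t)) / 2 := by
  have hρ : 0 < ρ := ht.trans_le htρ
  have h1 : t ^ μ ≤ ρ ^ μ := Real.rpow_le_rpow ht.le htρ hμ.le
  have h2 : 0 < t ^ μ := Real.rpow_pos_of_pos ht _
  have h3 : 0 < ρ ^ μ := Real.rpow_pos_of_pos hρ _
  rw [Real.rpow_add_one ht.ne', Real.rpow_add_one hρ.ne']
  have h4 : t ^ μ * t * x ≤ (ρ ^ μ * (t / ρ) + ρ ^ μ * ρ * (x ^ 2 * t)) / 2 := by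
    have h5 : t ^ μ * t * x ≤ t ^ μ * t * ((1 / ρ + ρ * x ^ 2) / 2) := by
      gcongr
      have : 0 ≤ (1 / ρ + ρ * x ^ 2) / 2 - x := by
        have : (1 / ρ + ρ * x ^ 2) / 2 - x = (1 - ρ * x) ^ 2 / (2 * ρ) := by
          field_simp; ring
        rw [this]; positivity
      linarith
    have h6 : t ^ μ * t * ((1 / ρ + ρ * x ^ 2) / 2) ≤ ρ ^ μ * t * ((1 / ρ + ρ * x ^ 2) / 2) := by
      gcongr
    calc _ ≤ _ := h5.trans h6
      _ = _ := by field_simp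
  have h7 : ρ ^ μ * (t / ρ) ≤ ρ ^ μ * 1 := by
    gcongr
    exact (div_le_one hρ).2 htρ
  linarith

section Moment

variable {R μ : ℝ} {f : ℝ → ℂ}

theorem integrableOn_moment (hμ : 0 < μ)
    (hfm : AEStronglyMeasurable f (volume.restrict (Ioo 0 R)))
    (hf : IntegrableOn (fun t => ‖f t‖ ^ 2 * t) (Ioo 0 R)) :
    IntegrableOn (fun t => ((t ^ (μ + 1) : ℝ) : ℂ) * f t) (Ioo 0 R) := by
  have h1 : IntegrableOn (fun t => (R ^ μ + R ^ (μ + 1) * (‖f t‖ ^ 2 * t)) / 2) (Ioo 0 R) :=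
    (Integrable.add (integrable_const _) (hf.const_mul _)).div_const 2
  refine Integrable.mono' h1 ?_ ?_
  · exact ((continuousOn_ofReal_rpow _ R).aestronglyMeasurable measurableSet_Ioo).mul hfm
  · filter_upwards [ae_restrict_mem measurableSet_Ioo] with t ht
    rw [norm_mul, Complex.norm_real, Real.norm_of_nonneg (Real.rpow_nonneg ht.1.le _)]
    exact rpow_succ_mul_le hμ ht.1 ht.2.le

theorem radialMoment_isBigO_of_sq_integrable (hR : 0 < R) (hμ : 0 < μ)
    (hf : IntegrableOn (fun t => ‖f t‖ ^ 2 * t) (Ioo 0 R)) :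
    radialMoment μ f =O[nhdsWithin 0 (Ioi 0)] fun r : ℝ => r ^ (μ + 1) := by
  refine Asymptotics.IsBigO.of_bound ((1 + ∫ t in Ioo 0 R, ‖f t‖ ^ 2 * t) / 2) ?_
  filter_upwards [Ioo_mem_nhdsGT hR] with r hr
  have hi : IntervalIntegrable (fun t => ‖f t‖ ^ 2 * t) volume 0 r := by
    rw [intervalIntegrable_iff_integrableOn_Ioc_of_le hr.1.le]
    exact hf.mono_set fun t ht => ⟨ht.1, ht.2.trans_lt hr.2⟩
  have hle : ∫ t in (0 : ℝ)..r, ‖f t‖ ^ 2 * t ≤ ∫ t in Ioo 0 R, ‖f t‖ ^ 2 * t := by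
    rw [intervalIntegral.integral_of_le hr.1.le]
    refine setIntegral_mono_set hf ?_ (Eventually.of_forall fun t ht => ⟨ht.1, ht.2.trans_lt hr.2⟩)
    filter_upwards [ae_restrict_mem measurableSet_Ioo] with t ht
    exact mul_nonneg (sq_nonneg _) ht.1.le
  rw [Real.norm_of_nonneg (Real.rpow_nonneg hr.1.le _)]
  calc ‖radialMoment μ f r‖
      ≤ ∫ t in (0 : ℝ)..r, (r ^ μ + r ^ (μ + 1) * (‖f t‖ ^ 2 * t)) / 2 := by
        refine intervalIntegral.norm_integral_le_of_norm_le hr.1.le (ae_of_all _ fun t ht => ?_) ?_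
        · rw [norm_mul, Complex.norm_real, Real.norm_of_nonneg (Real.rpow_nonneg ht.1.le _)]
          exact rpow_succ_mul_le hμ ht.1 ht.2
        · exact (intervalIntegrable_const.add (hi.const_mul _)).div_const 2
    _ = (1 + ∫ t in (0 : ℝ)..r, ‖f t‖ ^ 2 * t) / 2 * r ^ (μ + 1) := by
        rw [intervalIntegral.integral_div, intervalIntegral.integral_add
          intervalIntegrable_const (hi.const_mul _),
          intervalIntegral.integral_const_mul, intervalIntegral.integral_const,
          Real.rpow_add_one hr.1.ne', smul_eq_mul]
        ring
    _ ≤ _ := by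
        have := Real.rpow_nonneg hr.1.le (μ + 1)
        gcongr

theorem radialMoment_isBigO_of_isBigO (hR : 0 < R) {A : ℝ → ℂ} {κ : ℝ} (hκ : -1 < κ + μ + 1)
    (hA : A =O[nhdsWithin 0 (Ioi 0)] fun r : ℝ => r ^ κ)
    (hfA : ∀ᵐ r, r ∈ Ioo 0 R → f r = A r) :
    radialMoment μ f =O[nhdsWithin 0 (Ioi 0)] fun r : ℝ => r ^ (κ + μ + 2) := by
  obtain ⟨C, δ, hC, hδ, hδR, hb⟩ := exists_bound_of_isBigO_rpow hR hA
  refine Asymptotics.IsBigO.of_bound (C / (κ + μ + 2)) ?_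
  filter_upwards [Ioo_mem_nhdsGT hδ] with r hr
  rw [Real.norm_of_nonneg (Real.rpow_nonneg hr.1.le _)]
  calc ‖radialMoment μ f r‖ ≤ ∫ t in (0 : ℝ)..r, C * t ^ (κ + μ + 1) := by
        refine intervalIntegral.norm_integral_le_of_norm_le hr.1.le ?_ ?_
        · filter_upwards [hfA] with t ht htI
          rw [ht ⟨htI.1, htI.2.trans_lt (hr.2.trans hδR)⟩, norm_mul, Complex.norm_real,
            Real.norm_of_nonneg (Real.rpow_nonneg htI.1.le _), add_assoc κ,
            Real.rpow_add htI.1 κ]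
          have h1 := hb t htI.1 (htI.2.trans hr.2.le)
          have h2 := Real.rpow_nonneg htI.1.le (μ + 1)
          calc _ ≤ t ^ (μ + 1) * (C * t ^ κ) := by gcongr
            _ = _ := by ring
        · exact (intervalIntegral.intervalIntegrable_rpow' hκ).const_mul C
    _ = C / (κ + μ + 2) * r ^ (κ + μ + 2) := by
        rw [intervalIntegral.integral_const_mul, integral_rpow (Or.inl hκ),
          Real.zero_rpow (by linarith)]
        ring_nf

end Moment

/-- If `c ≠ 0`, then `r^(1-2μ)` would be integrable at `0`, which requires `μ < 1`. -/
theorem eq_zero_of_sq_integrable_of_isBigO {R μ : ℝ} (hR : 0 < R) (hμ : 1 ≤ μ) {A : ℝ → ℂ} {c : ℂ}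
    (hA : IntegrableOn (fun t => ‖A t‖ ^ 2 * t) (Ioo 0 R))
    (hO : (fun r => A r - c * ((r ^ (-μ) : ℝ) : ℂ)) =O[nhdsWithin 0 (Ioi 0)]
      fun r : ℝ => r ^ (0 : ℝ)) : c = 0 := by
  by_contra hc
  obtain ⟨C, δ, hC, hδ, hδR, hb⟩ := exists_bound_of_isBigO_rpow hR hO
  have h1 : IntegrableOn (fun t : ℝ => 2 * (‖A t‖ ^ 2 * t) + 2 * C ^ 2 * t) (Ioo 0 δ) := by
    refine Integrable.add ((hA.mono_set (Ioo_subset_Ioo_right hδR.le)).const_mul 2) ?_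
    exact ((continuous_const.mul continuous_id).integrableOn_Icc).mono_set Ioo_subset_Icc_self
  have h2 : IntegrableOn (fun t : ℝ => ‖c‖ ^ 2 * t ^ (1 - 2 * μ)) (Ioo 0 δ) := by
    refine Integrable.mono' h1 ?_ ?_
    · refine ContinuousOn.aestronglyMeasurable ?_ measurableSet_Ioo
      exact continuousOn_const.mul
        (continuousOn_id.rpow_const fun _ hx => Or.inl (ne_of_gt hx.1))
    · filter_upwards [ae_restrict_mem measurableSet_Ioo] with t ht
      have h3 := hb t ht.1 ht.2.le
      rw [Real.rpow_zero, mul_one] at h3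
      have h4 : ‖c‖ * t ^ (-μ) ≤ ‖A t‖ + C := by
        have h5 : ‖c * ((t ^ (-μ) : ℝ) : ℂ)‖ = ‖c‖ * t ^ (-μ) := by
          rw [norm_mul, Complex.norm_real, Real.norm_of_nonneg (Real.rpow_nonneg ht.1.le _)]
        rw [← h5]
        have h6 := norm_sub_norm_le (c * ((t ^ (-μ) : ℝ) : ℂ)) (A t)
        rw [norm_sub_rev] at h6
        linarith
      have h7 : ‖c‖ ^ 2 * t ^ (1 - 2 * μ) = (‖c‖ * t ^ (-μ)) ^ 2 * t := by
        rw [show 1 - 2 * μ = -μ + -μ + 1 by ring, Real.rpow_add_one ht.1.ne', Real.rpow_add ht.1]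
        ring
      have h8 : 0 ≤ ‖c‖ * t ^ (-μ) :=
        mul_nonneg (norm_nonneg _) (Real.rpow_nonneg ht.1.le _)
      rw [h7, Real.norm_of_nonneg (mul_nonneg (sq_nonneg _) ht.1.le)]
      calc (‖c‖ * t ^ (-μ)) ^ 2 * t ≤ (2 * ‖A t‖ ^ 2 + 2 * C ^ 2) * t := by
            refine mul_le_mul_of_nonneg_right ?_ ht.1.le
            nlinarith [sq_nonneg (‖A t‖ - C)]
        _ = _ := by ring
  have h3 : IntegrableOn (fun t : ℝ => t ^ (1 - 2 * μ)) (Ioo 0 δ) := by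
    have h4 := h2.const_mul ((‖c‖ ^ 2)⁻¹)
    have h5 : ‖c‖ ^ 2 ≠ 0 := by simpa using hc
    refine h4.congr (Eventually.of_forall fun t => ?_)
    simp only
    rw [← mul_assoc, inv_mul_cancel₀ h5, one_mul]
  rw [intervalIntegral.integrableOn_Ioo_rpow_iff hδ] at h3
  linarith

/-- Behaviour at the origin of the weak solutions of `f'' + f'/r - μ² f/r² + z f = 0` which are
square integrable for `r dr`. -/
theorem exists_radial_asymptotics {R μ : ℝ} (hR : 0 < R) (hμ : 0 < μ) (hμ1 : μ ≠ 1) {z : ℂ}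
    {f : ℝ → ℂ} (hfm : AEStronglyMeasurable f (volume.restrict (Ioo 0 R)))
    (hf : IntegrableOn (fun t => ‖f t‖ ^ 2 * t) (Ioo 0 R))
    (H : ∀ ψ, IsTest R ψ →
      ∫ r, (((r ^ (-μ) * deriv (fun r => r ^ (2 * μ + 1) * deriv ψ r) r : ℝ) : ℂ)
        + z * ((r ^ (μ + 1) * ψ r : ℝ) : ℂ)) * f r = 0) :
    ∃ A : ℝ → ℂ, (∀ᵐ r, r ∈ Ioo 0 R → f r = A r) ∧
      (μ < 1 → ∃ c d : ℂ, (fun r : ℝ => A r - (c * ((r ^ (-μ) : ℝ) : ℂ) + d * ((r ^ μ : ℝ) : ℂ)))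
        =O[nhdsWithin 0 (Ioi 0)] fun r : ℝ => r ^ (2 - μ)) ∧
      (1 < μ → μ ≠ 3 → A =O[nhdsWithin 0 (Ioi 0)] fun r : ℝ => r ^ min μ 3) := by
  have hk := integrableOn_moment hμ hfm hf
  obtain ⟨c, d, hA⟩ := exists_radial_representation hR hμ hk H
  have hr₀ : R / 2 ∈ Ioo 0 R := ⟨by positivity, half_lt_self hR⟩
  set A : ℝ → ℂ := fun r => c * ((r ^ (-μ) : ℝ) : ℂ) + d * ((r ^ μ : ℝ) : ℂ)
      - z * ((r ^ μ : ℝ) : ℂ) *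
        ∫ ρ in (R / 2)..r, ((ρ ^ (-2 * μ - 1) : ℝ) : ℂ) * radialMoment μ f ρ with hA_def
  -- The gain mechanism: the integrand is `O(r^(e-2μ-1))`, its primitive is a constant plus
  -- `O(r^(e-2μ))`, and the constant is absorbed into `d'`. The exclusion `e ≠ 2μ` avoids a
  -- logarithm.
  have expand : ∀ e, e ≠ 2 * μ → radialMoment μ f =O[nhdsWithin 0 (Ioi 0)] (fun r : ℝ => r ^ e) →
      ∃ d' : ℂ, (fun r : ℝ => A r - (c * ((r ^ (-μ) : ℝ) : ℂ) + d' * ((r ^ μ : ℝ) : ℂ)))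
        =O[nhdsWithin 0 (Ioi 0)] fun r : ℝ => r ^ (e - μ) := by
    intro e he hI
    have h1 := isBigO_rpow_mul (p := -2 * μ - 1) rfl hI
    obtain ⟨d₁, hd₁⟩ := exists_primitive_sub_const_isBigO
      ((continuousOn_ofReal_rpow _ R).mul (continuousOn_radialMoment hk)) h1
      (fun h => he (by linarith)) hr₀
    refine ⟨d - z * d₁, ?_⟩
    have h2 := (isBigO_rpow_mul (p := μ) (s := e - μ) (by ring) hd₁).const_mul_left (-z)
    refine h2.congr_left fun r => ?_
    simp only [hA_def, Pi.mul_apply]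
    ring
  obtain ⟨d₁, h1⟩ := expand (μ + 1) (fun h => hμ1 (by linarith))
    (radialMoment_isBigO_of_sq_integrable hR hμ hf)
  refine ⟨A, hA, fun hlt => ?_, fun hgt h3 => ?_⟩
  -- The first pass has error `O(r)`. Feeding back the leading order `r^(-μ)` makes the moment
  -- `O(r²)`.
  · have h2 : A =O[nhdsWithin 0 (Ioi 0)] fun r : ℝ => r ^ (-μ) := by
      have h3 := ((h1.trans (rpow_isBigO_rpow_zero (q := -μ) (by linarith))).add
        (const_mul_rpow_isBigO_rpow_zero c le_rfl)).add
        (const_mul_rpow_isBigO_rpow_zero d₁ (p := μ) (q := -μ) (by linarith))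
      exact h3.congr_left fun r => by ring
    obtain ⟨d₂, h4⟩ := expand 2 (fun h => hμ1 (by linarith))
      (by simpa using radialMoment_isBigO_of_isBigO (μ := μ) hR (by linarith) h2 hA)
    exact ⟨c, d₂, h4⟩
  · have hAi : IntegrableOn (fun t => ‖A t‖ ^ 2 * t) (Ioo 0 R) := by
      refine hf.congr ?_
      filter_upwards [ae_restrict_of_ae hA, ae_restrict_mem measurableSet_Ioo] with t h1 h2
      rw [h1 h2]
    have hc : c = 0 := by
      refine eq_zero_of_sq_integrable_of_isBigO hR hgt.le hAi ?_
      have h3 := (h1.trans (rpow_isBigO_rpow_zero (q := 0) (by linarith))).add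
        (const_mul_rpow_isBigO_rpow_zero d₁ (p := μ) (q := 0) hμ.le)
      exact h3.congr_left fun r => by ring
    -- With `c = 0` the rough error `O(r)` dominates `r^μ`; it improves the moment to `O(r^(μ+3))`,
    -- and here `e ≠ 2μ` reads `μ ≠ 3`.
    have h2 : A =O[nhdsWithin 0 (Ioi 0)] fun r : ℝ => r ^ (1 : ℝ) := by
      have h3 := (h1.trans (rpow_isBigO_rpow_zero (q := 1) (by linarith))).add
        (const_mul_rpow_isBigO_rpow_zero d₁ (p := μ) (q := 1) hgt.le)
      exact h3.congr_left fun r => by rw [hc]; ring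
    obtain ⟨d₂, h4⟩ := expand _ (fun h => h3 (by linarith))
      (radialMoment_isBigO_of_isBigO (μ := μ) hR (by linarith) h2 hA)
    have h5 := (h4.trans (rpow_isBigO_rpow_zero (q := min μ 3) (by
      linarith [min_le_right μ 3]))).add
      (const_mul_rpow_isBigO_rpow_zero d₂ (p := μ) (q := min μ 3) (min_le_left _ _))
    exact h5.congr_left fun r => by rw [hc]; ring

/-! ### The operator `Y` on functions `G(|x|) x^n`. -/

/-- The covariant derivative of the Aharonov-Bohm potential in the direction `v`. -/
noncomputable def dirCov (α : ℝ) (v : ℂ) (f : ℂ → ℂ) (x : ℂ) : ℂ :=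
  fderiv ℝ f x v +
    Complex.I * α * (((x.re * v.im - x.im * v.re) / (x.re ^ 2 + x.im ^ 2) : ℝ) : ℂ) * f x

theorem covOne_eq_dirCov (α : ℝ) : covOne α = dirCov α 1 := by
  ext f x; simp [covOne, dirCov, partialOne]

theorem covTwo_eq_dirCov (α : ℝ) : covTwo α = dirCov α Complex.I := by
  ext f x; simp [covTwo, dirCov, partialTwo]

theorem dirCov_congr {α : ℝ} {v : ℂ} {f g : ℂ → ℂ} {x : ℂ} (h : f =ᶠ[nhds x] g) :
    dirCov α v f x = dirCov α v g x := by
  rw [dirCov, dirCov, h.fderiv_eq, h.eq_of_nhds]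

theorem Complex.norm_sq_eq_re_sq_add_im_sq (x : ℂ) : ‖x‖ ^ 2 = x.re ^ 2 + x.im ^ 2 := by
  rw [Complex.sq_norm, Complex.normSq_apply]; ring

theorem Complex.contDiffAt_real_zpow {x : ℂ} (hx : x ≠ 0) (n : ℤ) :
    ContDiffAt ℝ ∞ (fun y : ℂ => y ^ n) x :=
  (((analyticAt_id (𝕜 := ℂ) (z := x)).zpow hx).contDiffAt (n := ∞)).restrict_scalars ℝ

/-- The scalar by which multiplication by `x ^ n` shifts the covariant derivative. -/
noncomputable def angularFactor (n : ℤ) (α : ℝ) (v x : ℂ) : ℂ :=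
  (n * ((x.re * v.re + x.im * v.im : ℝ) : ℂ)
    + Complex.I * (n + α) * ((x.re * v.im - x.im * v.re : ℝ) : ℂ)) / ((‖x‖ ^ 2 : ℝ) : ℂ)

/-- With `p = x·v` and `q = x₁v₂ - x₂v₁` one has `v/x = (p + iq)/|x|²`; differentiating `x^n`
contributes `n` times this, and the potential contributes `iαq/|x|²`. -/
theorem dirCov_mul_zpow {α : ℝ} {v : ℂ} {w : ℂ → ℂ} {x : ℂ} (hx : x ≠ 0) (n : ℤ)
    (hw : DifferentiableAt ℝ w x) :
    dirCov α v (fun y => w y * y ^ n) x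
      = (fderiv ℝ w x v + angularFactor n α v x * w x) * x ^ n := by
  have h1 : HasFDerivAt (fun y : ℂ => y ^ n)
      ((ContinuousLinearMap.toSpanSingleton ℂ (n * x ^ (n - 1))).restrictScalars ℝ) x :=
    (hasDerivAt_zpow n x (Or.inl hx)).hasFDerivAt.restrictScalars ℝ
  have h2 := hw.hasFDerivAt.fun_mul h1
  have h3 : ((‖x‖ ^ 2 : ℝ) : ℂ) ≠ 0 := by
    exact_mod_cast pow_ne_zero 2 (norm_ne_zero_iff.2 hx)
  rw [dirCov, h2.fderiv, ← Complex.norm_sq_eq_re_sq_add_im_sq, angularFactor, zpow_sub_one₀ hx]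
  have h4 : v * ((‖x‖ ^ 2 : ℝ) : ℂ) = x * (((x.re * v.re + x.im * v.im : ℝ) : ℂ)
      + Complex.I * ((x.re * v.im - x.im * v.re : ℝ) : ℂ)) := by
    rw [Complex.norm_sq_eq_re_sq_add_im_sq]
    apply Complex.ext <;> simp [sq] <;> ring
  have h5 : v * x⁻¹ = (((x.re * v.re + x.im * v.im : ℝ) : ℂ)
      + Complex.I * ((x.re * v.im - x.im * v.re : ℝ) : ℂ)) / ((‖x‖ ^ 2 : ℝ) : ℂ) := by
    rw [eq_div_iff h3]
    field_simp
    push_cast at h4 ⊢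
    linear_combination h4
  have h6 : (((x.re * v.im - x.im * v.re) / ‖x‖ ^ 2 : ℝ) : ℂ)
      = ((x.re * v.im - x.im * v.re : ℝ) : ℂ) / ((‖x‖ ^ 2 : ℝ) : ℂ) := by push_cast; rfl
  rw [h6]
  simp only [add_apply, smul_apply, smul_eq_mul,
    ContinuousLinearMap.coe_restrictScalars', ContinuousLinearMap.toSpanSingleton_apply]
  linear_combination (w x * n * x ^ n) * h5

theorem hasLineDerivAt_norm {x v : ℂ} (hx : x ≠ 0) :
    HasDerivAt (fun t : ℝ => ‖x + t • v‖) ((x.re * v.re + x.im * v.im) / ‖x‖) 0 := by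
  have h1 : ∀ y : ℂ, ‖y‖ = √(y.re ^ 2 + y.im ^ 2) := fun y => by
    rw [← Complex.norm_sq_eq_re_sq_add_im_sq, Real.sqrt_sq (norm_nonneg _)]
  have h2 : HasDerivAt (fun t : ℝ => (x.re + t * v.re) ^ 2 + (x.im + t * v.im) ^ 2)
      (2 * (x.re * v.re + x.im * v.im)) 0 := by
    have e1 : HasDerivAt (fun t : ℝ => x.re + t * v.re) v.re 0 := by
      simpa using ((hasDerivAt_id (0 : ℝ)).mul_const v.re).const_add x.re
    have e2 : HasDerivAt (fun t : ℝ => x.im + t * v.im) v.im 0 := by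
      simpa using ((hasDerivAt_id (0 : ℝ)).mul_const v.im).const_add x.im
    convert! (e1.pow 2).add (e2.pow 2) using 1
    simp; ring
  have h3 : x.re ^ 2 + x.im ^ 2 ≠ 0 := by
    rw [← Complex.norm_sq_eq_re_sq_add_im_sq]; exact pow_ne_zero 2 (norm_ne_zero_iff.2 hx)
  have h4 := h2.sqrt (by simpa using h3)
  convert! h4 using 1
  · ext t; rw [h1]; simp
  · rw [h1 x]; simp; field_simp

section Radial

variable {G : ℝ → ℝ}

theorem differentiableAt_comp_norm (hG : Differentiable ℝ G) {x : ℂ} (hx : x ≠ 0) :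
    DifferentiableAt ℝ (fun y : ℂ => ((G ‖y‖ : ℝ) : ℂ)) x :=
  Complex.ofRealCLM.differentiableAt.comp x
    ((hG _).comp x ((contDiffAt_norm ℝ hx (n := 1)).differentiableAt one_ne_zero))

theorem hasLineDerivAt_comp_norm (hG : Differentiable ℝ G) {x : ℂ} (v : ℂ) (hx : x ≠ 0) :
    HasDerivAt (fun t : ℝ => ((G ‖x + t • v‖ : ℝ) : ℂ))
      ((deriv G ‖x‖ * ((x.re * v.re + x.im * v.im) / ‖x‖) : ℝ) : ℂ) 0 := by
  have h1 : HasDerivAt G (deriv G ‖x‖) ‖x + (0 : ℝ) • v‖ := by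
    simpa using (hG ‖x‖).hasDerivAt
  exact (h1.comp 0 (hasLineDerivAt_norm hx)).ofReal_comp

theorem fderiv_eq_of_hasLineDerivAt {w : ℂ → ℂ} {x v d : ℂ} (hw : DifferentiableAt ℝ w x)
    (h : HasDerivAt (fun t : ℝ => w (x + t • v)) d 0) : fderiv ℝ w x v = d := by
  rw [← hw.lineDeriv_eq_fderiv]
  exact h.deriv

/-- Every derivative is computed along the line `x + t v`. Since `|v| = 1`, `p` grows at unit rate
on it while `q` stays constant. -/
theorem dirCov_dirCov_radial (hG : ContDiff ℝ ∞ G) {α : ℝ} {v x : ℂ} (hv : ‖v‖ = 1) (hx : x ≠ 0)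
    (n : ℤ) :
    dirCov α v (dirCov α v fun y => ((G ‖y‖ : ℝ) : ℂ) * y ^ n) x =
      (((deriv (deriv G) ‖x‖ * ((x.re * v.re + x.im * v.im) / ‖x‖) ^ 2
          + deriv G ‖x‖ * (1 / ‖x‖ - (x.re * v.re + x.im * v.im) ^ 2 / ‖x‖ ^ 3) : ℝ) : ℂ)
        + 2 * angularFactor n α v x *
          ((deriv G ‖x‖ * ((x.re * v.re + x.im * v.im) / ‖x‖) : ℝ) : ℂ)
        + (n / ((‖x‖ ^ 2 : ℝ) : ℂ) - 2 * angularFactor n α v x *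
            (((x.re * v.re + x.im * v.im) / ‖x‖ ^ 2 : ℝ) : ℂ)
          + angularFactor n α v x ^ 2) * ((G ‖x‖ : ℝ) : ℂ)) * x ^ n := by
  have hGd : Differentiable ℝ G := hG.differentiable (by simp)
  have hG' : ContDiff ℝ ∞ (deriv G) := (contDiff_infty_iff_deriv.1 hG).2
  have hGd' : Differentiable ℝ (deriv G) := hG'.differentiable (by simp)
  set p : ℂ → ℝ := fun y => y.re * v.re + y.im * v.im with hp
  set q : ℂ → ℝ := fun y => y.re * v.im - y.im * v.re with hq
  set W : ℂ → ℂ := fun y => ((deriv G ‖y‖ * (p y / ‖y‖) : ℝ) : ℂ)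
    + angularFactor n α v y * ((G ‖y‖ : ℝ) : ℂ) with hW
  have h1 : (dirCov α v fun y => ((G ‖y‖ : ℝ) : ℂ) * y ^ n) =ᶠ[nhds x] fun y => W y * y ^ n := by
    filter_upwards [isOpen_ne.mem_nhds hx] with y hy
    have hd := differentiableAt_comp_norm hGd hy
    rw [dirCov_mul_zpow hy n hd, fderiv_eq_of_hasLineDerivAt hd (hasLineDerivAt_comp_norm hGd v hy)]
  have hn : DifferentiableAt ℝ (fun y : ℂ => ‖y‖) x :=
    (contDiffAt_norm ℝ hx (n := 1)).differentiableAt one_ne_zero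
  have hx0 : ‖x‖ ≠ 0 := norm_ne_zero_iff.2 hx
  have hpd : DifferentiableAt ℝ p x :=
    (Complex.reCLM.differentiableAt.mul_const _).add (Complex.imCLM.differentiableAt.mul_const _)
  have hqd : DifferentiableAt ℝ q x :=
    (Complex.reCLM.differentiableAt.mul_const _).sub (Complex.imCLM.differentiableAt.mul_const _)
  have ofR : ∀ {g : ℂ → ℝ}, DifferentiableAt ℝ g x → DifferentiableAt ℝ (fun y => (g y : ℂ)) x :=
    fun hg => Complex.ofRealCLM.differentiableAt.comp x hg
  have hn2 : ((‖x‖ ^ 2 : ℝ) : ℂ) ≠ 0 := by exact_mod_cast pow_ne_zero 2 hx0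
  have hA : DifferentiableAt ℝ (angularFactor n α v) x := by
    have hd : DifferentiableAt ℝ (fun y : ℂ => ((‖y‖ ^ 2 : ℝ) : ℂ)) x := ofR (hn.fun_pow 2)
    exact (((ofR hpd).const_mul _).fun_add ((ofR hqd).const_mul _)).fun_mul (hd.fun_inv hn2)
  have hWd : DifferentiableAt ℝ W x :=
    (ofR (((hGd' _).comp x hn).fun_mul (hpd.fun_mul (hn.fun_inv hx0)))).add
      (hA.mul (differentiableAt_comp_norm hGd hx))
  rw [dirCov_congr h1, dirCov_mul_zpow hx n hWd]
  congr 1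
  have lp : HasDerivAt (fun t : ℝ => p (x + t • v)) 1 0 := by
    have e1 : (fun t : ℝ => p (x + t • v)) = fun t => p x + t * (v.re ^ 2 + v.im ^ 2) := by
      ext t; simp [hp]; ring
    rw [e1, ← Complex.norm_sq_eq_re_sq_add_im_sq, hv]
    simpa using (hasDerivAt_id (0 : ℝ)).const_add (p x)
  have lq : HasDerivAt (fun t : ℝ => q (x + t • v)) 0 0 := by
    have e1 : (fun t : ℝ => q (x + t • v)) = fun t => q x := by
      ext t; simp [hq]; ring
    rw [e1]; exact hasDerivAt_const _ _
  have ln := hasLineDerivAt_norm (v := v) hx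
  have h00 : x + (0 : ℝ) • v = x := by simp
  have lA : HasDerivAt (fun t : ℝ => angularFactor n α v (x + t • v))
      (n / ((‖x‖ ^ 2 : ℝ) : ℂ) - 2 * angularFactor n α v x * ((p x / ‖x‖ ^ 2 : ℝ) : ℂ)) 0 := by
    have e1 := ((lp.ofReal_comp.const_mul (n : ℂ)).add
      (lq.ofReal_comp.const_mul (Complex.I * (n + α)))).div (ln.pow 2).ofReal_comp (by simpa using hx)
    convert! e1 using 1
    simp only [h00, angularFactor, Pi.add_apply, Pi.pow_apply]
    simp only [hp, hq]
    have hx0' : (‖x‖ : ℂ) ≠ 0 := by exact_mod_cast hx0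
    push_cast
    field_simp
    ring
  have l1 := ((hasLineDerivAt_comp_norm hGd' v hx).mul (lp.div ln (by simpa using hx)).ofReal_comp).add
    (lA.mul (hasLineDerivAt_comp_norm hGd v hx))
  rw [fderiv_eq_of_hasLineDerivAt hWd (d := _) (by
    refine HasDerivAt.congr_of_eventuallyEq l1 (Eventually.of_forall fun t => ?_)
    simp [hW])]
  simp only [h00, hW, Pi.div_apply]
  have hx0' : (‖x‖ : ℂ) ≠ 0 := by exact_mod_cast hx0
  change _ = ((deriv (deriv G) ‖x‖ * (p x / ‖x‖) ^ 2
          + deriv G ‖x‖ * (1 / ‖x‖ - (p x) ^ 2 / ‖x‖ ^ 3) : ℝ) : ℂ)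
        + 2 * angularFactor n α v x * ((deriv G ‖x‖ * (p x / ‖x‖) : ℝ) : ℂ)
        + (n / ((‖x‖ ^ 2 : ℝ) : ℂ) - 2 * angularFactor n α v x * ((p x / ‖x‖ ^ 2 : ℝ) : ℂ)
          + angularFactor n α v x ^ 2) * ((G ‖x‖ : ℝ) : ℂ)
  have e2 : x.re * v.re + x.im * v.im = p x := rfl
  rw [e2]
  push_cast
  field_simp
  ring

/-- Over the two coordinate directions the sums of `p²` and of `q²` are both `|x|²`, while the
products `p q` cancel; hence only radial coefficients survive. -/
theorem abY_radial (hG : ContDiff ℝ ∞ G) (α : ℝ) {x : ℂ} (hx : x ≠ 0) (n : ℤ) :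
    abY α (fun y => ((G ‖y‖ : ℝ) : ℂ) * y ^ n) x =
      -((deriv (deriv G) ‖x‖ + (2 * n + 1) * deriv G ‖x‖ / ‖x‖
        + (n ^ 2 - (n + α) ^ 2) / ‖x‖ ^ 2 * G ‖x‖ : ℝ) : ℂ) * x ^ n := by
  rw [abY, covOne_eq_dirCov, covTwo_eq_dirCov, dirCov_dirCov_radial hG (by simp) hx,
    dirCov_dirCov_radial hG (by simp) hx]
  have hx0' : (‖x‖ : ℂ) ≠ 0 := by exact_mod_cast norm_ne_zero_iff.2 hx
  have h1 : (‖x‖ : ℂ) ^ 2 = (x.re : ℂ) ^ 2 + (x.im : ℂ) ^ 2 := by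
    exact_mod_cast Complex.norm_sq_eq_re_sq_add_im_sq x
  simp only [angularFactor, Complex.one_re, Complex.one_im, Complex.I_re, Complex.I_im]
  rw [← neg_mul, ← sub_mul]
  congr 1
  push_cast
  set ρ : ℂ := (‖x‖ : ℂ)
  set g0 : ℂ := (G ‖x‖ : ℂ)
  set g1 : ℂ := ((deriv G ‖x‖ : ℝ) : ℂ)
  set g2 : ℂ := ((deriv (deriv G) ‖x‖ : ℝ) : ℂ)
  have hb : (x.im : ℂ) ^ 2 = ρ ^ 2 - (x.re : ℂ) ^ 2 := by rw [h1]; ring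
  field_simp
  ring_nf
  simp only [Complex.I_sq, hb]
  ring
end Radial

theorem IsTest.tsupport_radial_subset {G : ℝ → ℝ} {a b : ℝ} (hs : tsupport G ⊆ Icc a b) (n : ℤ) :
    tsupport (fun y : ℂ => ((G ‖y‖ : ℝ) : ℂ) * y ^ n) ⊆ {y | a ≤ ‖y‖ ∧ ‖y‖ ≤ b} := by
  refine closure_minimal (fun y hy => hs (subset_tsupport G fun h => hy ?_)) ?_
  · simp [h]
  · exact (isClosed_le continuous_const continuous_norm).inter
      (isClosed_le continuous_norm continuous_const)

theorem IsTest.contDiff_radial {R : ℝ} {G : ℝ → ℝ} (hR : 0 < R) (hG : IsTest R G) (n : ℤ) :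
    ContDiff ℝ ∞ (fun y : ℂ => ((G ‖y‖ : ℝ) : ℂ) * y ^ n) := by
  obtain ⟨a, b, ha, -, -, hs⟩ := hG.exists_Icc hR
  rw [contDiff_iff_contDiffAt]
  intro x
  by_cases hx : x = 0
  · have : (fun y : ℂ => ((G ‖y‖ : ℝ) : ℂ) * y ^ n) =ᶠ[nhds x] fun _ => 0 := by
      have h1 : x ∉ tsupport (fun y : ℂ => ((G ‖y‖ : ℝ) : ℂ) * y ^ n) := fun h => by
        have := (IsTest.tsupport_radial_subset hs n h).1
        rw [hx, norm_zero] at this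
        linarith
      filter_upwards [(isClosed_tsupport _).isOpen_compl.mem_nhds h1] with y hy
      exact Function.notMem_support.1 fun h => hy (subset_tsupport _ h)
    exact contDiffAt_const.congr_of_eventuallyEq this
  · have h1 : ContDiffAt ℝ ∞ (fun y : ℂ => G ‖y‖) x :=
      hG.contDiff.contDiffAt.comp x (contDiffAt_norm ℝ hx)
    exact (Complex.ofRealCLM.contDiff.contDiffAt.comp x h1).mul (Complex.contDiffAt_real_zpow hx n)

/-! ### Polar coordinates and the radial equation for angular modes. -/

/-- A point of the plane in polar coordinates. -/
noncomputable def polarPoint (p : ℝ × ℝ) : ℂ := (p.1 : ℂ) * Complex.exp (Complex.I * p.2)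

/-- Lebesgue measure on the domain `(0, ∞) × (-π, π)` of the polar coordinates. -/
noncomputable def polarMeasure : Measure (ℝ × ℝ) :=
  (volume.restrict (Ioi 0)).prod (volume.restrict (Ioo (-Real.pi) Real.pi))

theorem continuous_polarPoint : Continuous polarPoint := by
  unfold polarPoint; fun_prop

theorem polarCoord_symm_eq_polarPoint (p : ℝ × ℝ) :
    Complex.polarCoord.symm p = polarPoint p := by
  rw [Complex.polarCoord_symm_apply, polarPoint, mul_comm Complex.I, Complex.exp_mul_I]
  simp

theorem norm_polarPoint (p : ℝ × ℝ) : ‖polarPoint p‖ = |p.1| := by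
  rw [← polarCoord_symm_eq_polarPoint, Complex.norm_polarCoord_symm]

theorem volume_restrict_polarCoord_target :
    (volume : Measure (ℝ × ℝ)).restrict polarCoord.target = polarMeasure := by
  rw [polarMeasure, Measure.prod_restrict]; rfl

theorem lintegral_polarPoint (f : ℂ → ENNReal) :
    ∫⁻ p, ENNReal.ofReal p.1 * f (polarPoint p) ∂polarMeasure = ∫⁻ x, f x := by
  rw [← Complex.lintegral_comp_polarCoord_symm, volume_restrict_polarCoord_target]
  simp_rw [polarCoord_symm_eq_polarPoint, smul_eq_mul]

theorem integral_polarPoint (f : ℂ → ℂ) :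
    ∫ p, (p.1 : ℂ) * f (polarPoint p) ∂polarMeasure = ∫ x, f x := by
  rw [← Complex.integral_comp_polarCoord_symm, volume_restrict_polarCoord_target]
  simp_rw [polarCoord_symm_eq_polarPoint, Complex.real_smul]

theorem ae_polarMeasure_pos : ∀ᵐ p ∂polarMeasure, 0 < p.1 := by
  rw [← volume_restrict_polarCoord_target]
  filter_upwards [ae_restrict_mem polarCoord.open_target.measurableSet] with p hp
  exact hp.1

/-- The Jacobian `r` is positive on the coordinate domain, so the change of variables pulls null
sets back to null sets. -/
theorem ae_polarPoint {P : ℂ → Prop} (h : ∀ᵐ x, P x) : ∀ᵐ p ∂polarMeasure, P (polarPoint p) := by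
  set N := toMeasurable volume {x | ¬ P x}
  have hN : MeasurableSet N := measurableSet_toMeasurable _ _
  have h0 : volume N = 0 := by rw [measure_toMeasurable]; exact h
  have h1 := lintegral_polarPoint (N.indicator 1)
  rw [lintegral_indicator_one hN, h0, lintegral_eq_zero_iff] at h1
  · filter_upwards [h1, ae_polarMeasure_pos] with p hp hp0
    by_contra hc
    have h2 : polarPoint p ∈ N := subset_toMeasurable _ _ hc
    simp [indicator_of_mem h2, hp0.not_ge] at hp
  · exact (measurable_fst.ennreal_ofReal).mul
      ((measurable_const.indicator hN).comp continuous_polarPoint.measurable)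

theorem integrable_polarPoint {E : Type*} [NormedAddCommGroup E] [NormedSpace ℝ E] {F : ℂ → E}
    (hm : StronglyMeasurable F) (hF : Integrable F) :
    Integrable (fun p => p.1 • F (polarPoint p)) polarMeasure := by
  refine ⟨(continuous_fst.stronglyMeasurable.smul
    (hm.comp_measurable continuous_polarPoint.measurable)).aestronglyMeasurable, ?_⟩
  have h1 := hF.2
  rw [HasFiniteIntegral, ← lintegral_polarPoint] at h1
  rw [HasFiniteIntegral]
  refine lt_of_le_of_lt (lintegral_mono_ae ?_) h1
  filter_upwards [ae_polarMeasure_pos] with p hp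
  rw [enorm_smul, Real.enorm_of_nonneg hp.le]

/-- The angular Fourier coefficients of a function on the plane. -/
noncomputable def angularCoeff (Φ : ℂ → ℂ) (n : ℤ) (r : ℝ) : ℂ :=
  (2 * Real.pi : ℂ)⁻¹ *
    ∫ θ in Ioo (-Real.pi) Real.pi, Complex.exp (-(Complex.I * n * θ)) * Φ (polarPoint (r, θ))

/-- The radial part of `-Y` acting on `G(|x|) x ^ n`. -/
noncomputable def radialOp (α : ℝ) (n : ℤ) (G : ℝ → ℝ) (r : ℝ) : ℝ :=
  deriv (deriv G) r + (2 * n + 1) * deriv G r / r + (n ^ 2 - (n + α) ^ 2) / r ^ 2 * G r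

theorem IsTest.radialOp {R α : ℝ} {G : ℝ → ℝ} (hG : IsTest R G) (n : ℤ) :
    IsTest R (radialOp α n G) := by
  have h1 := (hG.deriv_isTest.deriv_isTest.sub_const_mul
    (hG.deriv_isTest.rpow_mul (-1)) (-(2 * n + 1))).sub_const_mul (hG.rpow_mul (-2))
    (-(n ^ 2 - (n + α) ^ 2))
  convert h1 using 1
  ext r
  by_cases hr : r ∈ Ioo 0 R
  · have hr0 : r ≠ 0 := hr.1.ne'
    have e2 : r ^ (-2 : ℝ) = (r ^ 2)⁻¹ := by
      rw [Real.rpow_neg hr.1.le]; norm_cast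
    rw [_root_.radialOp, Real.rpow_neg_one, e2]
    field_simp
    ring
  · rw [_root_.radialOp, hG.eq_zero_of_notMem hr, hG.deriv_isTest.eq_zero_of_notMem hr,
      hG.deriv_isTest.deriv_isTest.eq_zero_of_notMem hr]
    simp

theorem IsTest.zpow_mul {R : ℝ} {G : ℝ → ℝ} (hG : IsTest R G) (m : ℤ) :
    IsTest R (fun r => r ^ m * G r) := by
  simpa using hG.rpow_mul (m : ℝ)

theorem conj_polarPoint_zpow {p : ℝ × ℝ} (n : ℤ) :
    conj (polarPoint p ^ n) = ((p.1 ^ n : ℝ) : ℂ) * Complex.exp (-(Complex.I * n * p.2)) := by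
  rw [polarPoint, mul_zpow, map_mul, ← Complex.exp_int_mul, ← Complex.exp_conj]
  simp only [map_mul, map_zpow₀, Complex.conj_ofReal, Complex.conj_I, map_intCast]
  push_cast
  congr 2
  ring

theorem integral_radial_mul {k : ℝ → ℂ} (hk : Continuous k) {C : ℝ}
    (hC : ∀ r, ‖k r‖ ≤ C) (hk0 : ∀ r, r ≤ 0 → k r = 0) {Φ : ℂ → ℂ} (hm : StronglyMeasurable Φ)
    (hΦ : Integrable Φ) (n : ℤ) :
    ∫ p, (p.1 : ℂ) * (k p.1 * Complex.exp (-(Complex.I * n * p.2)) * Φ (polarPoint p))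
      ∂polarMeasure = 2 * Real.pi * ∫ r : ℝ, (r : ℂ) * k r * angularCoeff Φ n r := by
  have h1 := integrable_polarPoint hm hΦ
  have h2 : Integrable (fun p : ℝ × ℝ => (k p.1 * Complex.exp (-(Complex.I * n * p.2))) *
      (p.1 • Φ (polarPoint p))) polarMeasure := by
    refine h1.bdd_mul (c := C) (Continuous.aestronglyMeasurable (by fun_prop)) ?_
    refine Eventually.of_forall fun p => ?_
    have h3 : ‖Complex.exp (-(Complex.I * n * p.2))‖ = 1 := by
      rw [Complex.norm_exp]; simp
    rw [norm_mul, h3, mul_one]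
    exact hC _
  have h3 : ∀ p : ℝ × ℝ, (p.1 : ℂ) * (k p.1 * Complex.exp (-(Complex.I * n * p.2)) *
      Φ (polarPoint p)) = (k p.1 * Complex.exp (-(Complex.I * n * p.2))) *
      (p.1 • Φ (polarPoint p)) := fun p => by rw [Complex.real_smul]; ring
  simp_rw [h3]
  rw [polarMeasure] at h2 ⊢
  rw [integral_prod _ h2, ← integral_const_mul]
  rw [← setIntegral_eq_integral_of_forall_compl_eq_zero (s := Ioi (0 : ℝ)) (μ := volume)
    (f := fun r : ℝ => 2 * (Real.pi : ℂ) * ((r : ℂ) * k r * angularCoeff Φ n r))]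
  · refine integral_congr_ae (Eventually.of_forall fun r => ?_)
    simp only [angularCoeff]
    have hpi : (Real.pi : ℂ) ≠ 0 := by exact_mod_cast Real.pi_ne_zero
    rw [show ∀ X : ℂ, 2 * (Real.pi : ℂ) * ((r : ℂ) * k r * ((2 * Real.pi : ℂ)⁻¹ * X))
      = (r : ℂ) * k r * X from fun X => by field_simp, ← integral_const_mul]
    congr 1
    ext θ
    rw [Complex.real_smul]; ring
  · intro r hr
    simp [hk0 r (not_lt.1 hr)]

theorem IsTest.exists_bound {R : ℝ} {G : ℝ → ℝ} (hG : IsTest R G) : ∃ C, ∀ r, ‖G r‖ ≤ C :=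
  hG.contDiff.continuous.bounded_above_of_compact_support hG.hasCompactSupport

/-- The angular modes of a weak solution solve the radial equation, tested against `r ^ n G`. -/
theorem WeaklySolves.radialOp_eq_zero {α R : ℝ} (hR : 0 < R) {z : ℂ} {φ Φ : ℂ → ℂ}
    (hsol : WeaklySolves α R z φ) (hφΦ : ∀ᵐ x, x ∈ Metric.ball (0 : ℂ) R → φ x = Φ x)
    (hm : StronglyMeasurable Φ) (hΦ : Integrable Φ) (n : ℤ) {G : ℝ → ℝ} (hG : IsTest R G) :
    ∫ r, (((r ^ (n + 1) * radialOp α n G r : ℝ) : ℂ) + z * ((r ^ (n + 1) * G r : ℝ) : ℂ))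
      * angularCoeff Φ n r = 0 := by
  obtain ⟨a, b, ha, hab, hb, hs⟩ := hG.exists_Icc hR
  have hsub := IsTest.tsupport_radial_subset hs n
  have h1 := hsol _ (hG.contDiff_radial hR n) (by
    refine HasCompactSupport.of_support_subset_isCompact (isCompact_closedBall (0 : ℂ) b) ?_
    exact (subset_tsupport _).trans (hsub.trans fun y hy => by simpa using hy.2)) (by
    intro y hy
    have hy' := hsub hy
    refine ⟨by simpa using hy'.2.trans_lt hb, fun h => ?_⟩
    rw [mem_singleton_iff] at h
    have := hy'.1
    rw [h, norm_zero] at this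
    linarith)
  set k : ℝ → ℂ := fun r => ((r ^ n * radialOp α n G r : ℝ) : ℂ) + z * ((r ^ n * G r : ℝ) : ℂ)
    with hk
  have hk1 : IsTest R fun r => r ^ n * radialOp α n G r := (hG.radialOp n).zpow_mul n
  have hk2 : IsTest R fun r => r ^ n * G r := hG.zpow_mul n
  obtain ⟨C₁, hC₁⟩ := hk1.exists_bound
  obtain ⟨C₂, hC₂⟩ := hk2.exists_bound
  have hkz : ∀ r, r ∉ Ioo 0 R → k r = 0 := fun r hr => by
    simp only [hk, hk1.eq_zero_of_notMem hr, hk2.eq_zero_of_notMem hr]; simp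
  have h2 := integral_radial_mul (k := k) (C := C₁ + ‖z‖ * C₂)
    ((Complex.continuous_ofReal.comp hk1.contDiff.continuous).add
      (continuous_const.mul (Complex.continuous_ofReal.comp hk2.contDiff.continuous)))
    (fun r => (norm_add_le _ _).trans (by
      rw [norm_mul, Complex.norm_real, Complex.norm_real]
      exact add_le_add (hC₁ r) (mul_le_mul_of_nonneg_left (hC₂ r) (norm_nonneg z))))
    (fun r hr => hkz r fun h => absurd h.1 (not_lt.2 hr)) hm hΦ n
  have h3 : ∫ p, (p.1 : ℂ) * (k p.1 * Complex.exp (-(Complex.I * n * p.2)) * Φ (polarPoint p))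
      ∂polarMeasure = 0 := by
    -- Up to sign this is the weak equation for `G(|x|) x^n`: `G` is real, so conjugation only turns
    -- `conj z` into `z` and `x^n` into its conjugate.
    have h4 : ∫ x, (((radialOp α n G ‖x‖ : ℝ) : ℂ) + z * ((G ‖x‖ : ℝ) : ℂ)) * conj (x ^ n) * Φ x
        = 0 := by
      rw [← neg_eq_zero, ← integral_neg, ← h1,
        ← setIntegral_eq_integral_of_forall_compl_eq_zero (s := Metric.ball (0 : ℂ) R)]
      · refine integral_congr_ae ?_
        have h5 : ∀ᵐ x : ℂ, x ≠ 0 := by simp [ae_iff, measure_singleton]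
        filter_upwards [ae_restrict_of_ae h5, ae_restrict_of_ae hφΦ,
          ae_restrict_mem measurableSet_ball] with x hx hx1 hx2
        rw [abY_radial hG.contDiff α hx n, hx1 hx2]
        simp only [map_sub, map_mul, map_neg, Complex.conj_ofReal, Complex.conj_conj]
        rw [_root_.radialOp]
        ring
      · intro x hx
        have hx' : ‖x‖ ∉ Ioo 0 R := fun h => hx (by simpa using h.2)
        rw [(hG.radialOp n).eq_zero_of_notMem hx', hG.eq_zero_of_notMem hx']
        simp
    rw [← h4, ← integral_polarPoint]
    refine integral_congr_ae ?_
    filter_upwards [ae_polarMeasure_pos] with p hp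
    rw [norm_polarPoint, abs_of_pos hp, conj_polarPoint_zpow]
    simp only [hk]; push_cast; ring
  rw [h3] at h2
  have hpi : (2 * Real.pi : ℂ) ≠ 0 := by
    simp [Real.pi_ne_zero]
  have h6 := (mul_eq_zero.1 h2.symm).resolve_left hpi
  rw [← h6]
  refine integral_congr_ae (Eventually.of_forall fun r => ?_)
  by_cases hr : r ∈ Ioo 0 R
  · simp only [hk]
    rw [zpow_add_one₀ hr.1.ne']
    push_cast; ring
  · beta_reduce
    rw [hkz r hr, (hG.radialOp n).eq_zero_of_notMem hr, hG.eq_zero_of_notMem hr]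
    simp

/-- Conjugation of the radial operator with a power. -/
theorem rpow_mul_radialOp {α μ : ℝ} {n : ℤ} (hμ : μ ^ 2 = (n + α) ^ 2) {ψ : ℝ → ℝ}
    (hψ : ContDiff ℝ ∞ ψ) {r : ℝ} (hr : 0 < r) :
    r ^ (n + 1) * radialOp α n (fun r => r ^ (μ - n) * ψ r) r
      = r ^ (-μ) * deriv (fun r => r ^ (2 * μ + 1) * deriv ψ r) r := by
  have hψd : Differentiable ℝ ψ := hψ.differentiable (by simp)
  have hψd' : Differentiable ℝ (deriv ψ) :=
    (contDiff_infty_iff_deriv.1 hψ).2.differentiable (by simp)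
  have hp : ∀ (q : ℝ) {s : ℝ}, 0 < s → HasDerivAt (fun s : ℝ => s ^ q) (q * s ^ (q - 1)) s :=
    fun q s hs => Real.hasDerivAt_rpow_const (Or.inl hs.ne')
  set p := μ - n with hp_def
  have d1 : ∀ {s : ℝ}, 0 < s → deriv (fun r => r ^ p * ψ r) s
      = p * s ^ (p - 1) * ψ s + s ^ p * deriv ψ s := fun {s} hs =>
    ((hp p hs).fun_mul (hψd s).hasDerivAt).deriv
  have d2 : deriv (deriv fun r => r ^ p * ψ r) r
      = p * ((p - 1) * r ^ (p - 1 - 1)) * ψ r + p * r ^ (p - 1) * deriv ψ r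
        + (p * r ^ (p - 1) * deriv ψ r + r ^ p * deriv (deriv ψ) r) := by
    have h1 : (deriv fun r => r ^ p * ψ r) =ᶠ[nhds r]
        fun s => p * s ^ (p - 1) * ψ s + s ^ p * deriv ψ s := by
      filter_upwards [Ioi_mem_nhds hr] with s hs using d1 hs
    rw [h1.deriv_eq]
    exact ((((hp (p - 1) hr).const_mul p).fun_mul (hψd r).hasDerivAt).fun_add
      ((hp p hr).fun_mul (hψd' r).hasDerivAt)).deriv
  have d3 : deriv (fun r => r ^ (2 * μ + 1) * deriv ψ r) r
      = (2 * μ + 1) * r ^ (2 * μ + 1 - 1) * deriv ψ r + r ^ (2 * μ + 1) * deriv (deriv ψ) r :=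
    ((hp _ hr).fun_mul (hψd' r).hasDerivAt).deriv
  rw [radialOp, d1 hr, d2, d3]
  have e1 : r ^ (2 * μ + 1 - 1) = r ^ μ * r ^ μ := by rw [← Real.rpow_add hr]; ring_nf
  have e2 : r ^ (2 * μ + 1) = r ^ μ * r ^ μ * r := by
    rw [← Real.rpow_add hr, ← Real.rpow_add_one hr.ne']; ring_nf
  have e3 : r ^ p = r ^ μ / r ^ n := by rw [hp_def, Real.rpow_sub hr, Real.rpow_intCast]
  have hrn : r ^ n ≠ 0 := zpow_ne_zero n hr.ne'
  have hrμ : r ^ μ ≠ 0 := (Real.rpow_pos_of_pos hr μ).ne'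
  rw [Real.rpow_sub_one hr.ne', Real.rpow_sub_one hr.ne', e1, e2, e3, Real.rpow_neg hr.le,
    zpow_add_one₀ hr.ne']
  have hn : (n : ℝ) = μ - p := by rw [hp_def]; ring
  -- The exponent `p = μ - n` is a root of the indicial equation `(p + n)² = (n + α)²`, which
  -- cancels the zeroth-order term.
  rw [← hμ, hn]
  field_simp
  ring

/-- Substituting `G = r^(μ-n) ψ` leaves an equation whose operator depends on `n` only through `μ`.
-/
theorem WeaklySolves.radial_weak_equation {α R : ℝ} (hR : 0 < R) {z : ℂ} {φ Φ : ℂ → ℂ}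
    (hsol : WeaklySolves α R z φ) (hφΦ : ∀ᵐ x, x ∈ Metric.ball (0 : ℂ) R → φ x = Φ x)
    (hm : StronglyMeasurable Φ) (hΦ : Integrable Φ) (n : ℤ) {μ : ℝ} (hμ : μ ^ 2 = (n + α) ^ 2)
    {ψ : ℝ → ℝ} (hψ : IsTest R ψ) :
    ∫ r, (((r ^ (-μ) * deriv (fun r => r ^ (2 * μ + 1) * deriv ψ r) r : ℝ) : ℂ)
        + z * ((r ^ (μ + 1) * ψ r : ℝ) : ℂ)) * angularCoeff Φ n r = 0 := by
  rw [← hsol.radialOp_eq_zero hR hφΦ hm hΦ n (hψ.rpow_mul (μ - n))]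
  congr 1
  ext r
  by_cases hr : r ∈ Ioo 0 R
  · rw [rpow_mul_radialOp hμ hψ.contDiff hr.1, ← mul_assoc, ← Real.rpow_intCast,
      ← Real.rpow_add hr.1]
    push_cast
    ring_nf
  · have h1 := (hψ.rpow_mul (μ - n)).radialOp n (α := α)
    rw [h1.eq_zero_of_notMem hr, (hψ.deriv_isTest.rpow_mul (2 * μ + 1)).deriv_isTest.eq_zero_of_notMem hr,
      hψ.eq_zero_of_notMem hr]
    simp

/-! ### Fourier series on circles. -/

/-- The Fourier series of a square integrable function on `(a, b]` converges in `L²`. -/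
theorem tendsto_eLpNorm_sub_fourier {a b : ℝ} {f : ℝ → ℂ} (hab : a < b)
    (hf : MemLp f 2 (volume.restrict (Ioc a b))) :
    Tendsto (fun s : Finset ℤ => eLpNorm (fun x => f x -
      ∑ n ∈ s, fourierCoeffOn hab f n * fourier n (x : AddCircle (b - a))) 2
        (volume.restrict (Ioc a b))) atTop (nhds 0) := by
  have hT := Fact.mk (sub_pos.2 hab)
  have hab' : a + (b - a) = b := add_sub_cancel a b
  set g : AddCircle (b - a) → ℂ := AddCircle.liftIoc (b - a) a f with hg
  have h1 : MemLp g 2 (@AddCircle.haarAddCircle (b - a) hT) := by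
    rw [← hab'] at hf
    exact hf.memLp_liftIoc.haarAddCircle
  have h2 := hasSum_fourier_series_L2 h1.toLp
  rw [HasSum, SummationFilter.unconditional_filter, Lp.tendsto_Lp_iff_tendsto_eLpNorm'] at h2
  have h3 : ∀ s : Finset ℤ, eLpNorm (fun x => f x -
      ∑ n ∈ s, fourierCoeffOn hab f n * fourier n (x : AddCircle (b - a))) 2
        (volume.restrict (Ioc a b)) = ENNReal.ofReal (b - a) ^ (1 / 2 : ENNReal).toReal *
      eLpNorm (⇑(∑ i ∈ s, fourierCoeff h1.toLp i • fourierLp 2 i) - ⇑h1.toLp) 2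
        (@AddCircle.haarAddCircle (b - a) hT) := by
    intro s
    have e1 : (⇑(∑ i ∈ s, fourierCoeff h1.toLp i • fourierLp 2 i) - ⇑h1.toLp)
        =ᵐ[@AddCircle.haarAddCircle (b - a) hT]
        fun y => ∑ n ∈ s, fourierCoeffOn hab f n * fourier n y - g y := by
      have e2 : ∀ᵐ y ∂(@AddCircle.haarAddCircle (b - a) hT), ∀ n : ℤ,
          (fourierCoeff h1.toLp n • fourierLp (T := b - a) 2 n : Lp ℂ 2 _) y
            = fourierCoeffOn hab f n * fourier n y := by
        rw [ae_all_iff]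
        intro n
        filter_upwards [Lp.coeFn_smul (fourierCoeff h1.toLp n) (fourierLp (T := b - a) 2 n),
          coeFn_fourierLp (T := b - a) 2 n] with y hy1 hy2
        rw [hy1, Pi.smul_apply, hy2, smul_eq_mul, fourierCoeff_congr_ae h1.coeFn_toLp]
        rfl
      filter_upwards [Lp.coeFn_finsetSum s fun i => fourierCoeff h1.toLp i • fourierLp (T := b - a) 2 i,
        h1.coeFn_toLp, e2] with y hy1 hy2 hy3
      rw [Pi.sub_apply, hy1, hy2, Finset.sum_apply]
      simp_rw [hy3]
    -- Haar measure on the circle has mass `1` and Lebesgue measure mass `b - a`, whence the factor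
    -- `(b - a)^(1/2)`.
    rw [eLpNorm_congr_ae e1, ← smul_eq_mul, ← eLpNorm_smul_measure_of_ne_top (by simp),
      ← AddCircle.volume_eq_smul_haarAddCircle]
    have hmp := AddCircle.measurePreserving_mk (b - a) a
    rw [hab'] at hmp
    have hgm : AEStronglyMeasurable
        (fun y : AddCircle (b - a) => ∑ n ∈ s, fourierCoeffOn hab f n * fourier n y - g y) volume :=
      (continuous_finsetSum _ fun n _ =>
        continuous_const.mul (fourier n).continuous).aestronglyMeasurable.sub
        (memLp_haarAddCircle_iff.1 h1).1
    rw [← eLpNorm_comp_measurePreserving hgm hmp]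
    refine eLpNorm_congr_norm_ae ?_
    filter_upwards [ae_restrict_mem measurableSet_Ioc] with x hx
    rw [Function.comp_apply, hg, AddCircle.liftIoc_coe_apply (by rwa [hab']), norm_sub_rev]
  simp_rw [h3]
  have := ENNReal.Tendsto.const_mul (a := ENNReal.ofReal (b - a) ^ (1 / 2 : ENNReal).toReal) h2
    (Or.inr (by finiteness))
  simpa using this

theorem fourier_neg_pi_pi (n : ℤ) (θ : ℝ) :
    fourier n (θ : AddCircle (Real.pi - -Real.pi)) = Complex.exp (Complex.I * n * θ) := by
  have hpi : (Real.pi : ℂ) ≠ 0 := by exact_mod_cast Real.pi_ne_zero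
  rw [fourier_coe_apply]
  congr 1
  push_cast
  field_simp
  ring

theorem neg_pi_lt_pi : -Real.pi < Real.pi := by linarith [Real.pi_pos]

theorem angularCoeff_eq_fourierCoeffOn (Φ : ℂ → ℂ) (n : ℤ) (r : ℝ) :
    angularCoeff Φ n r = fourierCoeffOn neg_pi_lt_pi (fun θ => Φ (polarPoint (r, θ))) n := by
  rw [fourierCoeffOn_eq_integral, angularCoeff, intervalIntegral.integral_of_le neg_pi_lt_pi.le,
    integral_Ioc_eq_integral_Ioo, Complex.real_smul]
  congr 1
  · push_cast; ring
  · refine integral_congr_ae (Eventually.of_forall fun θ => ?_)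
    beta_reduce
    rw [fourier_neg_pi_pi, smul_eq_mul]
    push_cast
    ring_nf

theorem stronglyMeasurable_angularCoeff {Φ : ℂ → ℂ} (hm : StronglyMeasurable Φ) (n : ℤ) :
    StronglyMeasurable (angularCoeff Φ n) := by
  refine StronglyMeasurable.const_mul ?_ _
  refine StronglyMeasurable.integral_prod_right (f := fun r θ : ℝ =>
    Complex.exp (-(Complex.I * n * θ)) * Φ (polarPoint (r, θ))) ?_
  exact (Continuous.stronglyMeasurable (by fun_prop)).mul
    (hm.comp_measurable continuous_polarPoint.measurable)

section SquareIntegrable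

variable {Φ : ℂ → ℂ}

theorem integrable_sq_polarPoint (hm : StronglyMeasurable Φ) (hΦ : MemLp Φ 2) :
    Integrable (fun p : ℝ × ℝ => p.1 • ‖Φ (polarPoint p)‖ ^ 2) polarMeasure :=
  integrable_polarPoint (F := fun x => ‖Φ x‖ ^ 2) (hm.norm.pow 2)
    ((memLp_two_iff_integrable_sq_norm hm.aestronglyMeasurable).1 hΦ)

theorem memLp_circle (hm : StronglyMeasurable Φ) (hΦ : MemLp Φ 2) :
    ∀ᵐ r ∂(volume.restrict (Ioi (0 : ℝ))), MemLp (fun θ => Φ (polarPoint (r, θ))) 2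
      (volume.restrict (Ioc (-Real.pi) Real.pi)) := by
  have h1 := integrable_sq_polarPoint hm hΦ
  rw [polarMeasure] at h1
  filter_upwards [h1.prod_right_ae, ae_restrict_mem measurableSet_Ioi] with r hr hr0
  rw [Measure.restrict_congr_set Ioo_ae_eq_Ioc.symm, memLp_two_iff_integrable_sq_norm]
  · have h2 := hr.const_mul r⁻¹
    refine h2.congr (Eventually.of_forall fun θ => ?_)
    have : r ≠ 0 := ne_of_gt hr0
    simp only [smul_eq_mul]
    field_simp
  · exact (hm.comp_measurable (continuous_polarPoint.measurable.comp
      measurable_prodMk_left)).aestronglyMeasurable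

/-- Bessel's inequality on almost every circle bounds one coefficient by the mean of `|Φ|²`;
integration against `r dr` gives the claim. -/
theorem integrableOn_sq_angularCoeff (hm : StronglyMeasurable Φ) (hΦ : MemLp Φ 2) (n : ℤ) :
    IntegrableOn (fun r => ‖angularCoeff Φ n r‖ ^ 2 * r) (Ioi 0) := by
  have h1 := integrable_sq_polarPoint hm hΦ
  rw [polarMeasure] at h1
  refine Integrable.mono' (h1.integral_prod_left.const_mul ((Real.pi - -Real.pi)⁻¹)) ?_ ?_
  · exact ((((stronglyMeasurable_angularCoeff hm n).norm.pow 2)).mul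
      stronglyMeasurable_id).aestronglyMeasurable
  · filter_upwards [memLp_circle hm hΦ, ae_restrict_mem measurableSet_Ioi] with r hr hr0
    have hr0 : 0 < r := hr0
    rw [Real.norm_of_nonneg (by positivity), angularCoeff_eq_fourierCoeffOn]
    have h2 := le_hasSum (hasSum_sq_fourierCoeffOn neg_pi_lt_pi hr) n fun _ _ => sq_nonneg _
    rw [intervalIntegral.integral_of_le neg_pi_lt_pi.le, integral_Ioc_eq_integral_Ioo,
      smul_eq_mul] at h2
    simp only [smul_eq_mul]
    rw [integral_const_mul]
    calc _ ≤ _ := mul_le_mul_of_nonneg_right h2 hr0.le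
      _ = _ := by ring

end SquareIntegrable

/-! ### Asymptotics of all modes and the expansion. -/

/-- The asymptotics of all angular modes of a weak solution. -/
theorem WeaklySolves.exists_mode_asymptotics {α R : ℝ} (hR : 0 < R) (hα0 : 0 < α) (hα1 : α < 1)
    {z : ℂ} {φ Φ : ℂ → ℂ} (hsol : WeaklySolves α R z φ)
    (hφΦ : ∀ᵐ x, x ∈ Metric.ball (0 : ℂ) R → φ x = Φ x) (hm : StronglyMeasurable Φ)
    (hΦ : Integrable Φ) (hΦ2 : MemLp Φ 2) (n : ℤ) :
    ∃ A : ℝ → ℂ, (∀ᵐ r, r ∈ Ioo 0 R → angularCoeff Φ n r = A r) ∧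
      (n = 0 → ∃ c d : ℂ, (fun r : ℝ => A r - (c * ((r ^ (-α) : ℝ) : ℂ) + d * ((r ^ α : ℝ) : ℂ)))
        =O[nhdsWithin 0 (Ioi 0)] fun r : ℝ => r ^ min (2 - α) (1 + α)) ∧
      (n = -1 → ∃ c d : ℂ,
        (fun r : ℝ => A r - (c * ((r ^ (-1 + α) : ℝ) : ℂ) + d * ((r ^ (1 - α) : ℝ) : ℂ)))
        =O[nhdsWithin 0 (Ioi 0)] fun r : ℝ => r ^ min (2 - α) (1 + α)) ∧
      (n ≠ 0 → n ≠ -1 →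
        A =O[nhdsWithin 0 (Ioi 0)] fun r : ℝ => r ^ min (2 - α) (1 + α)) := by
  have key : ∀ μ : ℝ, 0 < μ → μ ≠ 1 → μ ^ 2 = (n + α) ^ 2 → _ := fun μ h0 h1 h2 =>
    exists_radial_asymptotics (z := z) hR h0 h1
      (stronglyMeasurable_angularCoeff hm n).aestronglyMeasurable
      ((integrableOn_sq_angularCoeff hm hΦ2 n).mono_set Ioo_subset_Ioi_self)
      fun ψ hψ => hsol.radial_weak_equation hR hφΦ hm hΦ n h2 hψ
  by_cases hn0 : n = 0
  · obtain ⟨A, hA, h1, -⟩ := key α hα0 hα1.ne (by simp [hn0])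
    obtain ⟨c, d, h2⟩ := h1 hα1
    exact ⟨A, hA, fun _ => ⟨c, d, h2.trans (rpow_isBigO_rpow_zero (min_le_left _ _))⟩,
      fun h => absurd (h ▸ hn0) (by decide), fun h => absurd hn0 h⟩
  by_cases hn1 : n = -1
  · obtain ⟨A, hA, h1, -⟩ := key (1 - α) (by linarith) (by linarith) (by rw [hn1]; push_cast; ring)
    obtain ⟨c, d, h2⟩ := h1 (by linarith)
    refine ⟨A, hA, fun h => absurd h hn0, fun _ => ⟨c, d, ?_⟩, fun _ h => absurd hn1 h⟩
    rw [show -(1 - α) = -1 + α by ring] at h2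
    exact h2.trans (rpow_isBigO_rpow_zero (by linarith [min_le_right (2 - α) (1 + α)]))
  have hγ3 : min (2 - α) (1 + α) ≤ 3 := (min_le_left _ _).trans (by linarith)
  -- Here `μ = |n + α|`; the value `3` would force `n` strictly between consecutive integers.
  obtain ⟨μ, hμ1, hμ3, hμ2, hμγ⟩ : ∃ μ : ℝ, 1 < μ ∧ μ ≠ 3 ∧ μ ^ 2 = (n + α) ^ 2 ∧
      min (2 - α) (1 + α) ≤ μ := by
    rcases lt_or_gt_of_ne hn0 with hn | hn
    · have hn2 : n ≤ -2 := by omega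
      have hn2' : (n : ℝ) ≤ -2 := by exact_mod_cast hn2
      refine ⟨-(n + α), by linarith, fun h => ?_, by ring,
        (min_le_left _ _).trans (by linarith)⟩
      have h1 : (-4 : ℝ) < n := by linarith
      have h2 : (n : ℝ) < -3 := by linarith
      have h1' : -4 < n := by exact_mod_cast h1
      have h2' : n < -3 := by exact_mod_cast h2
      omega
    · have hn2 : 1 ≤ n := by omega
      have hn2' : (1 : ℝ) ≤ n := by exact_mod_cast hn2
      refine ⟨n + α, by linarith, fun h => ?_, rfl, (min_le_right _ _).trans (by linarith)⟩
      have h1 : (2 : ℝ) < n := by linarith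
      have h2 : (n : ℝ) < 3 := by linarith
      have h1' : 2 < n := by exact_mod_cast h1
      have h2' : n < 3 := by exact_mod_cast h2
      omega
  obtain ⟨A, hA, -, h1⟩ := key μ (by linarith) hμ1.ne' hμ2
  exact ⟨A, hA, fun h => absurd h hn0, fun h => absurd h hn1,
    fun _ _ => (h1 hμ1 hμ3).trans (rpow_isBigO_rpow_zero (le_min hμγ hγ3))⟩

theorem mainTheorem5 (R : ℝ) (hR : 0 < R) (α : ℝ) (hα0 : 0 < α) (hα1 : α < 1)
    (z : ℂ) (hz : ∀ t : ℝ, 0 < t → z ≠ (t : ℂ))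
    (φ : ℂ → ℂ)
    (hφ : MeasureTheory.MemLp φ 2 (MeasureTheory.volume.restrict (Metric.ball (0 : ℂ) R)))
    (hsol : WeaklySolves α R z φ) :
    ∃ c₀ d₀ c₁ d₁ : ℂ,
      ModewiseBigO R (min (2 - α) (1 + α)) (fun r θ : ℝ =>
        φ ((r : ℂ) * Complex.exp (Complex.I * θ)) -
          (c₀ * ((r ^ (-α) : ℝ) : ℂ) + d₀ * ((r ^ α : ℝ) : ℂ) +
            (c₁ * ((r ^ (-1 + α) : ℝ) : ℂ) + d₁ * ((r ^ (1 - α) : ℝ) : ℂ)) *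
              Complex.exp (-(Complex.I * θ)))) := by
  have hball : MeasurableSet (Metric.ball (0 : ℂ) R) := measurableSet_ball
  -- A strongly measurable representative, extended by zero, so that restrictions to circles are
  -- measurable.
  set Φ : ℂ → ℂ := (Metric.ball (0 : ℂ) R).indicator (hφ.1.mk φ) with hΦ_def
  have hm : StronglyMeasurable Φ := hφ.1.stronglyMeasurable_mk.indicator hball
  have hmk : MemLp (hφ.1.mk φ) 2 (volume.restrict (Metric.ball (0 : ℂ) R)) :=
    hφ.ae_eq hφ.1.ae_eq_mk
  have hΦ2 : MemLp Φ 2 := (memLp_indicator_iff_restrict hball).2 hmk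
  have hfin : IsFiniteMeasure (volume.restrict (Metric.ball (0 : ℂ) R)) :=
    isFiniteMeasure_restrict.2 measure_ball_lt_top.ne
  have hΦ1 : Integrable Φ := by
    rw [hΦ_def, integrable_indicator_iff hball]
    exact hmk.integrable (by norm_num)
  have hφΦ : ∀ᵐ x, x ∈ Metric.ball (0 : ℂ) R → φ x = Φ x := by
    rw [← ae_restrict_iff' hball]
    filter_upwards [hφ.1.ae_eq_mk, ae_restrict_mem hball] with x hx hxb
    rw [hx, hΦ_def, indicator_of_mem hxb]
  choose A hA hA0 hA1 hA2 using
    hsol.exists_mode_asymptotics hR hα0 hα1 hφΦ hm hΦ1 hΦ2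
  obtain ⟨c₀, d₀, h0⟩ := hA0 0 rfl
  obtain ⟨c₁, d₁, h1⟩ := hA1 (-1) rfl
  -- The pointwise defined representatives `A n` are used, since angular coefficients agree with
  -- them only almost everywhere and the `O` bounds hold at every small `r`.
  refine ⟨c₀, d₀, c₁, d₁, fun n r => A n r -
    ((if n = 0 then c₀ * ((r ^ (-α) : ℝ) : ℂ) + d₀ * ((r ^ α : ℝ) : ℂ) else 0) +
     (if n = -1 then c₁ * ((r ^ (-1 + α) : ℝ) : ℂ) + d₁ * ((r ^ (1 - α) : ℝ) : ℂ) else 0)),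
    ?_, fun n => ?_⟩
  · have hae : ∀ᵐ r ∂(volume.restrict (Ioi (0 : ℝ))),
        ∀ᵐ θ ∂(volume.restrict (Ioc (-Real.pi) Real.pi)),
          polarPoint (r, θ) ∈ Metric.ball (0 : ℂ) R →
            φ (polarPoint (r, θ)) = Φ (polarPoint (r, θ)) := by
      have h2 := ae_polarPoint hφΦ
      rw [polarMeasure] at h2
      rw [Measure.restrict_congr_set Ioo_ae_eq_Ioc.symm]
      exact Measure.ae_ae_of_ae_prod h2
    have hA' : ∀ᵐ r : ℝ, ∀ n, r ∈ Ioo 0 R → angularCoeff Φ n r = A n r := ae_all_iff.2 hA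
    have hle : volume.restrict (Ioo 0 R) ≤ volume.restrict (Ioi (0 : ℝ)) :=
      Measure.restrict_mono Ioo_subset_Ioi_self le_rfl
    filter_upwards [ae_mono hle hae, ae_mono hle (memLp_circle hm hΦ2), ae_restrict_of_ae hA',
      ae_restrict_mem measurableSet_Ioo] with r hr1 hr2 hr3 hrI
    have hfe : (fun θ : ℝ => φ ((r : ℂ) * Complex.exp (Complex.I * θ)))
        =ᵐ[volume.restrict (Ioc (-Real.pi) Real.pi)] fun θ => Φ (polarPoint (r, θ)) := by
      filter_upwards [hr1] with θ hθ
      refine hθ ?_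
      rw [mem_ball_zero_iff, norm_polarPoint, abs_of_pos hrI.1]
      exact hrI.2
    refine ⟨?_, ?_⟩
    · refine (hr2.ae_eq hfe.symm).sub ?_
      refine MemLp.of_bound (C := ‖c₀ * ((r ^ (-α) : ℝ) : ℂ) + d₀ * ((r ^ α : ℝ) : ℂ)‖ +
        ‖c₁ * ((r ^ (-1 + α) : ℝ) : ℂ) + d₁ * ((r ^ (1 - α) : ℝ) : ℂ)‖)
        (Continuous.aestronglyMeasurable (by fun_prop)) (Eventually.of_forall fun θ => ?_)
      refine (norm_add_le _ _).trans ?_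
      have h3 : ‖Complex.exp (-(Complex.I * θ))‖ = 1 := by
        rw [Complex.norm_exp]; simp
      rw [norm_mul _ (Complex.exp _), h3, mul_one]
    · refine (tendsto_eLpNorm_sub_fourier neg_pi_lt_pi hr2).congr' ?_
      -- Once a partial sum contains the indices `0` and `-1`, its corrections equal the subtracted
      -- leading terms exactly.
      filter_upwards [eventually_ge_atTop ({0, -1} : Finset ℤ)] with s hs
      refine eLpNorm_congr_ae ?_
      filter_upwards [hfe] with θ hθ
      have h0s : (0 : ℤ) ∈ s := hs (by simp)
      have h1s : (-1 : ℤ) ∈ s := hs (by simp)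
      simp_rw [fourier_neg_pi_pi, ← angularCoeff_eq_fourierCoeffOn, hr3 _ hrI]
      rw [hθ]
      simp_rw [sub_mul, add_mul, ite_mul, zero_mul]
      rw [Finset.sum_sub_distrib, Finset.sum_add_distrib, Finset.sum_ite_eq' s 0,
        Finset.sum_ite_eq' s (-1), if_pos h0s, if_pos h1s]
      simp
      ring
  · by_cases hn0 : n = 0
    · subst hn0
      simpa using h0
    by_cases hn1 : n = -1
    · subst hn1
      simpa using h1
    simpa [hn0, hn1] using hA2 n hn0 hn1
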